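/- Let $F$ be a non-Archimedean local field with ring of integers $\mathcal O$, uniformiser $\varpi$ and residue field $k$ of characteristic $p$, let $n\ge 0$, and let $R$ be an algebraically closed field of characteristic $l\neq p$. Put $G=\mathrm{GL}_n(F)$, $K=\mathrm{GL}_n(\mathcal O)$, $K^1=1+\varpi M_n(\mathcal O)$ and $G_f=\mathrm{GL}_n(k)=K/K^1$; all representations are over $R$, and $\mathrm{ind}$ denotes induction of finite groups, respectively compact induction from open subgroups of $G$. For a representation $\pi$ of $G_f$ let $\mathrm I(\pi)=\mathrm{ind}_K^G\,\mathrm{infl}_{G_f}^K\,\pi$ be its parahoric induction. Finite side. Let $B_f\subseteq G_f$ be the group of upper triangular matrices and $P_f=\mathrm{ind}_{B_f}^{G_f}\mathbf 1$. For each standard (block upper triangular) parabolic subgroup $J_f\supseteq B_f$ of $G_f$ let $M_{J_f}$ be its block diagonal Levi subgroup, $U_{J_f}\subseteq M_{J_f}$ the group of blockwise unipotent upper triangular matrices, and $X_{J_f}$ the set of characters $U_{J_f}\to R^\times$ that are nontrivial on every simple root group of $M_{J_f}$ and trivial on every non-simple positive root group. Let $$\Gamma_f=\bigoplus_{J_f}\bigoplus_{\chi\in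 X_{J_f}}\mathrm{ind}_{J_f}^{G_f}\,\mathrm{infl}_{M_{J_f}}^{J_f}\,\mathrm{ind}_{U_{J_f}}^{M_{J_f}}\chi ,$$ let $\mathcal I_f$ be the annihilator of $P_f$ in the group algebra $R[G_f]$, and let $Q_f=\Gamma_f/\mathcal I_f\Gamma_f$. $p$-adic side. Let $I\subseteq K$ be the Iwahori subgroup, that is, the preimage of $B_f$, and let $P=\mathrm{ind}_I^G\mathbf 1$. Let $\mathcal H(G)$ be the global Hecke algebra of locally constant compactly supported functions $G\to R$, acting on smooth representations through the $R$-valued Haar measure with $\mu(K^1)=1$, and let $\mathcal I$ be the annihilator of $P$ in $\mathcal H(G)$. Let $\Gamma=\mathrm I(\Gamma_f)$ and $Q=\Gamma/\mathcal I\,\Gamma$. Then $Q=\mathrm I(Q_f)$ as quotients of $\Gamma$: there is an isomorphism of representations of $G$ $$Q\;\xrightarrow{\ \sim\ }\;\mathrm I(Q_f)$$ whose composition with the quotient map $\Gamma\to Q$ is the map $\Gamma=\mathrm I(\Gamma_f)\to\mathrm I(Q_f)$ obtained by applying $\mathrm I$ to the quotient map $\Gamma_f\to Q_f$. -/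

import Mathlib

open scoped ValuativeRel

noncomputable section

namespace ParahoricGen

/-! ### Induction of representations -/

section Induction

variable {R : Type*} [CommRing R] {H G : Type*} [Group H] [Group G]
variable {V W : Type*} [AddCommGroup V] [Module R V] [AddCommGroup W] [Module R W]

/-- The space of `ind_H^G ρ` for a homomorphism `φ : H →* G` (in practice the inclusion of a
subgroup): functions `f : G → V` with `f (φ h * g) = ρ h (f g)` whose support lies in finitely many
cosets `φ(H) x`. When `H` is an open subgroup of a topological group and `ρ` is smooth this is
compact induction: the cosets `H x` are open, so "compact support modulo `H`" means "supported on
finitely many cosets", and such an `f` is automatically right invariant under an open subgroup. When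
`G` is finite the support condition is void and this is ordinary induction. -/
def cIndV (φ : H →* G) (ρ : Representation R H V) : Submodule R (G → V) where
  carrier := {f | (∀ h g, f (φ h * g) = ρ h (f g)) ∧
    ∃ s : Finset G, ∀ g, f g ≠ 0 → ∃ h, ∃ x ∈ s, g = φ h * x}
  zero_mem' := ⟨by simp, ∅, by simp⟩
  add_mem' := by
    classical
    rintro f₁ f₂ ⟨h₁, s₁, hs₁⟩ ⟨h₂, s₂, hs₂⟩
    refine ⟨fun h g => by simp [h₁, h₂], s₁ ∪ s₂, fun g hg => ?_⟩
    by_cases h0 : f₁ g = 0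
    · have h0' : f₂ g ≠ 0 := fun h' => hg (by simp [h0, h'])
      obtain ⟨h, x, hx, e⟩ := hs₂ g h0'
      exact ⟨h, x, Finset.mem_union_right _ hx, e⟩
    · obtain ⟨h, x, hx, e⟩ := hs₁ g h0
      exact ⟨h, x, Finset.mem_union_left _ hx, e⟩
  smul_mem' := by
    rintro r f ⟨h₁, s₁, hs₁⟩
    refine ⟨fun h g => by simp [h₁], s₁, fun g hg => hs₁ g fun h' => hg (by simp [h'])⟩

/-- The representation `ind_H^G ρ`: `G` acts by right translation, `(g • f) x = f (x * g)`. -/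
def cInd (φ : H →* G) (ρ : Representation R H V) : Representation R G (cIndV φ ρ) where
  toFun g :=
    { toFun := fun f => ⟨fun x => f.1 (x * g), by
        classical
        obtain ⟨h₁, s, hs⟩ := f.2
        refine ⟨fun h x => by simp only [mul_assoc, h₁], s.image (· * g⁻¹), fun x hx => ?_⟩
        obtain ⟨h, y, hy, e⟩ := hs _ hx
        exact ⟨h, y * g⁻¹, Finset.mem_image_of_mem _ hy, by rw [← mul_assoc, ← e]; group⟩⟩
      map_add' := fun _ _ => rfl
      map_smul' := fun _ _ => rfl }
  map_one' := by
    ext f x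
    simp
  map_mul' g₁ g₂ := by
    ext f x
    simp [mul_assoc]

/-- Functoriality of induction: `f ↦ T ∘ f`. -/
def cIndMap (φ : H →* G) {ρ : Representation R H V} {σ : Representation R H W}
    (T : ρ.IntertwiningMap σ) : (cInd φ ρ).IntertwiningMap (cInd φ σ) where
  toFun f := ⟨fun x => T (f.1 x), by
    obtain ⟨h₁, s, hs⟩ := f.2
    refine ⟨fun h x => by simp only [h₁, T.isIntertwining], s,
      fun x hx => hs x fun h' => hx ?_⟩
    simp only [h', map_zero]⟩
  map_add' f₁ f₂ := by
    ext x
    exact map_add T _ _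
  map_smul' r f := by
    ext x
    exact map_smul T _ _
  isIntertwining' g := rfl

/-- The one-dimensional representation attached to a character. -/
def charRep (χ : H →* Rˣ) : Representation R H R where
  toFun h := (χ h : R) • LinearMap.id
  map_one' := by
    ext
    simp
  map_mul' a b := by
    ext
    simp [mul_comm]

/-- The quotient map onto a quotient representation. -/
def quotientMap (ρ : Representation R G V) (N : Submodule R V)
    (hN : ∀ g, N ≤ N.comap (ρ g)) : ρ.IntertwiningMap (ρ.quotient N hN) where
  toLinearMap := N.mkQ
  isIntertwining' _ := rfl

end Induction

/-! ### Annihilators over the group algebra -/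

section GroupAlgebra

variable {R : Type*} [CommRing R] {G : Type*} [Group G]
variable {V W : Type*} [AddCommGroup V] [Module R V] [AddCommGroup W] [Module R W]

/-- The annihilator of a representation in the group algebra. -/
def groupAnn (π : Representation R G W) : Ideal (MonoidAlgebra R G) :=
  RingHom.ker π.asAlgebraHom

/-- `A V`, where `A` is the annihilator of `π` in the group algebra. -/
def groupAnnSpan (π : Representation R G W) (ρ : Representation R G V) : Submodule R V :=
  Submodule.span R {w | ∃ z ∈ groupAnn π, ∃ v, ρ.asAlgebraHom z v = w}

theorem groupAnnSpan_stable (π : Representation R G W) (ρ : Representation R G V) (g : G) :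
    groupAnnSpan π ρ ≤ (groupAnnSpan π ρ).comap (ρ g) := by
  refine Submodule.span_le.2 ?_
  rintro _ ⟨z, hz, v, rfl⟩
  refine Submodule.subset_span ⟨MonoidAlgebra.single g 1 * z, Ideal.mul_mem_left _ _ hz, v, ?_⟩
  simp [map_mul]

end GroupAlgebra

/-! ### The Hecke algebra of a locally profinite group and its action -/

section Hecke

variable {R : Type*} [Field R] {G : Type*} [Group G]
variable {V W : Type*} [AddCommGroup V] [Module R V] [AddCommGroup W] [Module R W]

/-- The elements of `U₀` under which `φ` is right invariant. -/
def rightStab (U₀ : Subgroup G) (φ : G → V) : Subgroup G where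
  carrier := {u | u ∈ U₀ ∧ ∀ g, φ (g * u) = φ g}
  one_mem' := ⟨U₀.one_mem, by simp⟩
  mul_mem' := by
    rintro a b ⟨ha, ha'⟩ ⟨hb, hb'⟩
    exact ⟨U₀.mul_mem ha hb, fun g => by rw [← mul_assoc, hb', ha']⟩
  inv_mem' := by
    rintro a ⟨ha, ha'⟩
    exact ⟨U₀.inv_mem ha, fun g => by rw [← ha' (g * a⁻¹), inv_mul_cancel_right]⟩

/-- The integral `∫_G φ(g) dg` of a locally constant, compactly supported function with values in
an `R`-vector space, for the `R`-valued Haar measure with `μ(U₀) = 1`, where `U₀` is a compact open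
subgroup all of whose open subgroups have index invertible in `R`. With `U ≤ U₀` the open subgroup
under which `φ` is right invariant, `μ(U) = [U₀ : U]⁻¹` and the integral is
`μ(U) * ∑_{x ∈ G/U} φ(x)`. -/
def haarIntegral (R : Type*) [Field R] {V : Type*} [AddCommGroup V] [Module R V]
    (U₀ : Subgroup G) (φ : G → V) : V :=
  (((rightStab U₀ φ).relIndex U₀ : ℕ) : R)⁻¹ •
    ∑ᶠ x : G ⧸ rightStab U₀ φ, φ x.out

theorem haarIntegral_eq (U₀ : Subgroup G) (φ : G → V) {U : Subgroup G}
    (h : rightStab U₀ φ = U) :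
    haarIntegral R U₀ φ = ((U.relIndex U₀ : ℕ) : R)⁻¹ • ∑ᶠ x : G ⧸ U, φ x.out := by
  subst h
  rfl

theorem haarIntegral_translate (U₀ : Subgroup G) (φ : G → V) (a : G) :
    haarIntegral R U₀ (fun g => φ (a * g)) = haarIntegral R U₀ φ := by
  have hU : rightStab U₀ (fun g => φ (a * g)) = rightStab U₀ φ := by
    ext u
    refine and_congr_right fun _ => ⟨fun h g => ?_, fun h g => ?_⟩
    · have := h (a⁻¹ * g)
      simpa [← mul_assoc] using this
    · simp only [← mul_assoc, h]
  rw [haarIntegral_eq U₀ _ hU, haarIntegral_eq U₀ φ rfl]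
  congr 1
  refine finsum_eq_of_bijective (fun x => a • x) (MulAction.bijective a) fun x => ?_
  obtain ⟨u, hu⟩ := QuotientGroup.mk_out_eq_mul (rightStab U₀ φ) (a * x.out)
  have hx : a • x = ((a * x.out : G) : G ⧸ rightStab U₀ φ) := by
    conv_lhs => rw [← QuotientGroup.out_eq' x]
    rfl
  rw [hx, hu, u.2.2]

theorem haarIntegral_map (U₀ : Subgroup G) (φ : G → V) (T : V →ₗ[R] W)
    (hT : Function.Injective T) :
    haarIntegral R U₀ (fun g => T (φ g)) = T (haarIntegral R U₀ φ) := by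
  have hU : rightStab U₀ (fun g => T (φ g)) = rightStab U₀ φ := by
    ext u
    exact and_congr_right fun _ => forall_congr' fun g => hT.eq_iff
  rw [haarIntegral_eq U₀ _ hU, haarIntegral_eq U₀ φ rfl, map_smul]
  congr 1
  exact (T.toAddMonoidHom.map_finsum_of_injective hT _).symm

/-- The underlying space of the global Hecke algebra `H(G)`: locally constant compactly supported
functions `G → R`. -/
def heckeAlgebra (R : Type*) [Field R] (G : Type*) [Group G] [TopologicalSpace G] :
    Submodule R (G → R) where
  carrier := {f | IsLocallyConstant f ∧ HasCompactSupport f}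
  zero_mem' := ⟨IsLocallyConstant.const 0, HasCompactSupport.zero⟩
  add_mem' := fun h₁ h₂ => ⟨h₁.1.add h₂.1, h₁.2.add h₂.2⟩
  smul_mem' := fun r _ h => ⟨h.1.comp (r • ·), h.2.smul_left (f := fun _ => r)⟩

/-- The action of `f ∈ H(G)` on a vector of a smooth representation: `f v = ∫_G f(g) ρ(g) v dg`,
with `μ(U₀) = 1`. -/
def heckeAction (U₀ : Subgroup G) (ρ : Representation R G V) (f : G → R) (v : V) : V :=
  haarIntegral R U₀ (fun g => f g • ρ g v)

theorem heckeAction_translate (U₀ : Subgroup G) (ρ : Representation R G V) (f : G → R) (v : V)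
    (a : G) : heckeAction U₀ ρ (fun g => f (a⁻¹ * g)) v = ρ a (heckeAction U₀ ρ f v) := by
  have hinj : Function.Injective (ρ a) :=
    Function.LeftInverse.injective (g := ρ a⁻¹) fun v => by
      rw [← Module.End.mul_apply, ← map_mul, inv_mul_cancel, map_one, Module.End.one_apply]
  unfold heckeAction
  rw [← haarIntegral_translate U₀ (fun g => f g • ρ g v) a⁻¹, ← haarIntegral_map U₀ _ (ρ a) hinj]
  congr 1
  funext g
  rw [map_smul, ← Module.End.mul_apply, ← map_mul, mul_inv_cancel_left]

variable [TopologicalSpace G]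

/-- The annihilator of a smooth representation in `H(G)`. -/
def heckeAnn (U₀ : Subgroup G) (π : Representation R G W) : Set (G → R) :=
  {f | f ∈ heckeAlgebra R G ∧ ∀ w, heckeAction U₀ π f w = 0}

/-- `A V`, where `A` is the annihilator of `π` in `H(G)`. -/
def heckeAnnSpan (U₀ : Subgroup G) (π : Representation R G W) (ρ : Representation R G V) :
    Submodule R V :=
  Submodule.span R {w | ∃ f ∈ heckeAnn U₀ π, ∃ v, heckeAction U₀ ρ f v = w}

theorem heckeAnnSpan_stable [IsTopologicalGroup G] (U₀ : Subgroup G) (π : Representation R G W)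
    (ρ : Representation R G V) (a : G) :
    heckeAnnSpan U₀ π ρ ≤ (heckeAnnSpan U₀ π ρ).comap (ρ a) := by
  refine Submodule.span_le.2 ?_
  rintro _ ⟨f, ⟨⟨hf₁, hf₂⟩, hf₃⟩, v, rfl⟩
  refine Submodule.subset_span ⟨fun g => f (a⁻¹ * g), ⟨⟨?_, ?_⟩, fun w => ?_⟩, v,
    heckeAction_translate U₀ ρ f v a⟩
  · exact hf₁.comp_continuous (continuous_const_mul a⁻¹)
  · exact hf₂.comp_homeomorph (Homeomorph.mulLeft a⁻¹)
  · rw [heckeAction_translate, hf₃, map_zero]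

end Hecke

/-! ### Standard parabolic subgroups of `GL_n` over a field -/

section Finite

variable {k : Type*} [Field k] {n : ℕ} {α : Type*} [LinearOrder α]

theorem blockTriangular_inv {b : Fin n → α} {g : GL (Fin n) k}
    (hg : (g : Matrix (Fin n) (Fin n) k).BlockTriangular b) :
    ((g⁻¹ : GL (Fin n) k) : Matrix (Fin n) (Fin n) k).BlockTriangular b := by
  have : Invertible (g : Matrix (Fin n) (Fin n) k) := Units.invertible g
  rw [Matrix.coe_units_inv]
  exact Matrix.blockTriangular_inv_of_blockTriangular hg

/-- The subgroup of block upper triangular matrices, for blocks given by a monotone labelling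
`b` of the indices. -/
def parabolic (k : Type*) [Field k] (b : Fin n → α) : Subgroup (GL (Fin n) k) where
  carrier := {g | (g : Matrix (Fin n) (Fin n) k).BlockTriangular b}
  one_mem' := Matrix.blockTriangular_one
  mul_mem' := fun h₁ h₂ => h₁.mul h₂
  inv_mem' := fun h => blockTriangular_inv h

/-- The Borel subgroup of upper triangular matrices. -/
def borel (k : Type*) [Field k] (n : ℕ) : Subgroup (GL (Fin n) k) :=
  parabolic k (id : Fin n → Fin n)

/-- The Levi subgroup of block diagonal matrices. -/
def levi (k : Type*) [Field k] (b : Fin n → α) : Subgroup (GL (Fin n) k) where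
  carrier := {g | ∀ i j, b i ≠ b j → (g : Matrix (Fin n) (Fin n) k) i j = 0}
  one_mem' := fun i j h => Matrix.one_apply_ne fun e => h (e ▸ rfl)
  mul_mem' := by
    intro x y hx hy i j h
    rw [Units.val_mul, Matrix.mul_apply]
    refine Finset.sum_eq_zero fun l _ => ?_
    by_cases hl : b i = b l
    · rw [hy l j (hl ▸ h), mul_zero]
    · rw [hx i l hl, zero_mul]
  inv_mem' := by
    intro x hx i j h
    rcases lt_or_gt_of_ne h with h | h
    · exact blockTriangular_inv (b := fun i => OrderDual.toDual (b i)) (g := x)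
        (fun i j hij => hx i j (ne_of_lt hij)) h
    · exact blockTriangular_inv (b := b) (g := x) (fun i j hij => hx i j (ne_of_gt hij)) h

/-- The block diagonal part of a matrix. -/
def blockDiagPart (b : Fin n → α) (M : Matrix (Fin n) (Fin n) k) : Matrix (Fin n) (Fin n) k :=
  Matrix.of fun i j => if b i = b j then M i j else 0

theorem blockDiagPart_one (b : Fin n → α) :
    blockDiagPart b (1 : Matrix (Fin n) (Fin n) k) = 1 := by
  ext i j
  by_cases h : i = j
  · subst h
    simp [blockDiagPart]
  · simp [blockDiagPart, Matrix.one_apply_ne h]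

theorem blockDiagPart_mul {b : Fin n → α} {M N : Matrix (Fin n) (Fin n) k}
    (hM : M.BlockTriangular b) (hN : N.BlockTriangular b) :
    blockDiagPart b (M * N) = blockDiagPart b M * blockDiagPart b N := by
  ext i j
  simp only [blockDiagPart, Matrix.of_apply, Matrix.mul_apply]
  split_ifs with h
  · refine Finset.sum_congr rfl fun l _ => ?_
    rcases lt_trichotomy (b i) (b l) with hl | hl | hl
    · rw [hN (h ▸ hl : b j < b l)]
      simp [hl.ne]
    · simp [hl, hl ▸ h]
    · rw [hM hl]
      simp [hl.ne']
  · refine (Finset.sum_eq_zero fun l _ => ?_).symm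
    by_cases hl : b i = b l
    · rw [if_neg (hl ▸ h : ¬ b l = b j), mul_zero]
    · rw [if_neg hl, zero_mul]

/-- The projection of a standard parabolic subgroup onto its Levi subgroup, with kernel the
unipotent radical. -/
def leviProj (k : Type*) [Field k] (b : Fin n → α) : parabolic k b →* levi k b where
  toFun g := ⟨⟨blockDiagPart b g.1, blockDiagPart b (g⁻¹).1, by
      rw [← blockDiagPart_mul g.2 (g⁻¹).2, ← blockDiagPart_one b, ← Units.val_mul]
      simp, by
      rw [← blockDiagPart_mul (g⁻¹).2 g.2, ← blockDiagPart_one b, ← Units.val_mul]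
      simp⟩, fun i j h => if_neg h⟩
  map_one' := by
    ext : 2
    exact blockDiagPart_one b
  map_mul' x y := by
    ext : 2
    exact blockDiagPart_mul x.2 y.2

theorem diag_mul {M N : Matrix (Fin n) (Fin n) k} (hM : M.BlockTriangular id)
    (hN : N.BlockTriangular id) (i : Fin n) : (M * N) i i = M i i * N i i := by
  rw [Matrix.mul_apply]
  refine Finset.sum_eq_single i (fun l _ hl => ?_) (by simp)
  rcases lt_or_gt_of_ne hl with h | h
  · rw [hM h, zero_mul]
  · rw [hN h, mul_zero]

/-- The group of blockwise unipotent upper triangular matrices, inside the Levi subgroup. -/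
def leviUnip (k : Type*) [Field k] (b : Fin n → α) : Subgroup (levi k b) where
  carrier := {u | (u.1 : Matrix (Fin n) (Fin n) k).BlockTriangular id ∧
    ∀ i, (u.1 : Matrix (Fin n) (Fin n) k) i i = 1}
  one_mem' := ⟨Matrix.blockTriangular_one, fun i => Matrix.one_apply_eq i⟩
  mul_mem' := by
    rintro x y ⟨hx, hx'⟩ ⟨hy, hy'⟩
    exact ⟨hx.mul hy, fun i => by
      rw [Subgroup.coe_mul, Units.val_mul, diag_mul hx hy, hx', hy', mul_one]⟩
  inv_mem' := by
    rintro x ⟨hx, hx'⟩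
    refine ⟨blockTriangular_inv hx, fun i => ?_⟩
    have h := diag_mul hx (blockTriangular_inv hx) i
    rw [hx', one_mul, ← Units.val_mul, mul_inv_cancel, Units.val_one, Matrix.one_apply_eq] at h
    exact h.symm

/-! ### The representations of the finite group -/

variable (R : Type*) [Field R] (k) (n)

/-- The generic characters of the group `U_c` of blockwise unipotent matrices, for the block
decomposition given by a composition `c` of `n`: nontrivial on every simple root group (entry
`(i, i + 1)` inside a block), trivial on every other positive root group (entry `(i, j)` inside a
block, `j > i + 1`). -/
def genericChars {n : ℕ} (c : Composition n) : Set (leviUnip k c.index →* Rˣ) :=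
  {χ | ∀ i j : Fin n, i < j → c.index i = c.index j →
    ((i : ℕ) + 1 = j → ∃ (u : leviUnip k c.index) (t : k),
      (u.1.1 : Matrix (Fin n) (Fin n) k) = Matrix.transvection i j t ∧ χ u ≠ 1) ∧
    ((i : ℕ) + 1 ≠ j → ∀ (u : leviUnip k c.index) (t : k),
      (u.1.1 : Matrix (Fin n) (Fin n) k) = Matrix.transvection i j t → χ u = 1)}

/-- `P_f`, the induction of the trivial representation from the Borel subgroup. -/
def finP : Representation R (GL (Fin n) k)
    (cIndV (borel k n).subtype (Representation.trivial R (borel k n) R)) :=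
  cInd (borel k n).subtype (Representation.trivial R (borel k n) R)

/-- The Gelfand-Graev representation `ind_{U_c}^{M_c} χ` of the Levi subgroup, inflated to the
standard parabolic subgroup. -/
def inflGelfandGraev {R : Type*} [Field R] {k : Type*} [Field k] {n : ℕ} (c : Composition n) (χ : leviUnip k c.index →* Rˣ) :
    Representation R (parabolic k c.index) (cIndV (leviUnip k c.index).subtype (charRep χ)) :=
  (cInd (leviUnip k c.index).subtype (charRep χ)).comp (leviProj k c.index)

/-- The index set of the summands of `Γ_f`: pairs of a standard parabolic subgroup, given by a
composition of `n`, and a generic character. -/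
abbrev GammaIndex : Type _ := Σ c : Composition n, genericChars k R c

/-- The space of the summand of `Γ_f` with index `i`. -/
def GammaSummand (i : GammaIndex k n R) : Type _ :=
  cIndV (parabolic k i.1.index).subtype (inflGelfandGraev i.1 i.2.1)

instance (i : GammaIndex k n R) : AddCommGroup (GammaSummand k n R i) :=
  inferInstanceAs
    (AddCommGroup (cIndV (parabolic k i.1.index).subtype (inflGelfandGraev i.1 i.2.1)))

instance (i : GammaIndex k n R) : Module R (GammaSummand k n R i) :=
  inferInstanceAs
    (Module R (cIndV (parabolic k i.1.index).subtype (inflGelfandGraev i.1 i.2.1)))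

/-- The summand `ind_{P_c}^{G_f} infl_{M_c}^{P_c} ind_{U_c}^{M_c} χ` of `Γ_f`. -/
def gammaSummand (i : GammaIndex k n R) :
    Representation R (GL (Fin n) k) (GammaSummand k n R i) :=
  cInd (parabolic k i.1.index).subtype (inflGelfandGraev i.1 i.2.1)

/-- The space of `Γ_f`. -/
def FinGammaV : Type _ := DirectSum (GammaIndex k n R) (GammaSummand k n R)

instance : AddCommGroup (FinGammaV k n R) :=
  inferInstanceAs (AddCommGroup (DirectSum (GammaIndex k n R) (GammaSummand k n R)))

instance : Module R (FinGammaV k n R) :=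
  inferInstanceAs (Module R (DirectSum (GammaIndex k n R) (GammaSummand k n R)))

/-- `Γ_f`, the direct sum over standard parabolic subgroups `P_c` and generic characters `χ` of
`ind_{P_c}^{G_f} infl_{M_c}^{P_c} ind_{U_c}^{M_c} χ`. -/
def finGamma : Representation R (GL (Fin n) k) (FinGammaV k n R) :=
  Representation.directSum (gammaSummand k n R)

/-- The subspace `I_f Γ_f`, with `I_f` the annihilator of `P_f` in the group algebra. -/
def finAnnGamma : Submodule R (FinGammaV k n R) :=
  groupAnnSpan (finP k n R) (finGamma k n R)

/-- `Q_f = Γ_f / I_f Γ_f`. -/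
def finQ : Representation R (GL (Fin n) k) (FinGammaV k n R ⧸ finAnnGamma k n R) :=
  (finGamma k n R).quotient (finAnnGamma k n R) (groupAnnSpan_stable _ _)

/-- The quotient map `Γ_f → Q_f`. -/
def finQuotientMap : (finGamma k n R).IntertwiningMap (finQ k n R) :=
  quotientMap (finGamma k n R) (finAnnGamma k n R) (groupAnnSpan_stable _ _)

end Finite

/-! ### The representations of the `p`-adic group -/

section Padic

variable (F : Type*) [Field F] [ValuativeRel F] (n : ℕ)

/-- A named form of an existing instance; it keeps the terms for the residue field small. -/
instance isLocalRingIntegers (F : Type*) [Field F] [ValuativeRel F] : IsLocalRing 𝒪[F] :=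
  inferInstance

/-- `GL_n` of a field (the ring structure is always the one underlying the field). -/
abbrev FinGL (k : Type*) [Field k] (n : ℕ) : Type _ := GL (Fin n) k

/-- The inclusion of `K = GL_n(𝒪)` into `G = GL_n(F)`. -/
def inclK : GL (Fin n) 𝒪[F] →* GL (Fin n) F :=
  Matrix.GeneralLinearGroup.map (algebraMap 𝒪[F] F)

/-- The reduction map from `K = GL_n(𝒪)` to `G_f = GL_n(k)`. -/
def redK : GL (Fin n) 𝒪[F] →* FinGL 𝓀[F] n :=
  Matrix.GeneralLinearGroup.map (IsLocalRing.residue 𝒪[F])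

/-- The pro-`p` radical `K¹ = 1 + ϖ M_n(𝒪)` of `K`, as a subgroup of `G`. -/
def proRadical : Subgroup (GL (Fin n) F) := (redK F n).ker.map (inclK F n)

/-- The Iwahori subgroup: the preimage in `K` of the Borel subgroup of `G_f`. -/
def iwahori : Subgroup (GL (Fin n) F) := ((borel 𝓀[F] n).comap (redK F n)).map (inclK F n)

variable {F n} {R : Type*} [Field R]
variable {V W : Type*} [AddCommGroup V] [Module R V] [AddCommGroup W] [Module R W]

/-- Inflation along `K → G_f`. -/
def inflK (ρ : Representation R (FinGL 𝓀[F] n) V) : Representation R (GL (Fin n) 𝒪[F]) V :=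
  ρ.comp (redK F n)

/-- The space of the parahoric induction of `ρ`. -/
abbrev ParahoricIndV (ρ : Representation R (FinGL 𝓀[F] n) V) : Submodule R (GL (Fin n) F → V) :=
  cIndV (inclK F n) (inflK ρ)

/-- Parahoric induction `ind_K^G infl_{G_f}^K ρ`. -/
def parahoricInd (ρ : Representation R (FinGL 𝓀[F] n) V) :
    Representation R (GL (Fin n) F) (ParahoricIndV ρ) :=
  cInd (inclK F n) (inflK ρ)

/-- Parahoric induction of a morphism of representations of `G_f`. -/
def parahoricIndMap {ρ : Representation R (FinGL 𝓀[F] n) V}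
    {σ : Representation R (FinGL 𝓀[F] n) W} (T : ρ.IntertwiningMap σ) :
    (parahoricInd ρ).IntertwiningMap (parahoricInd σ) :=
  cIndMap (inclK F n) (ρ := inflK ρ) (σ := inflK σ)
    ⟨T.toLinearMap, fun g => T.isIntertwining' (redK F n g)⟩

variable (F n R)

/-- `P = ind_I^G 1`, for the Iwahori subgroup `I`. -/
def padicP : Representation R (GL (Fin n) F)
    (cIndV (iwahori F n).subtype (Representation.trivial R (iwahori F n) R)) :=
  cInd (iwahori F n).subtype (Representation.trivial R (iwahori F n) R)

/-- The space of `Γ`. -/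
abbrev PadicGammaV : Type _ :=
  ParahoricIndV (finGamma 𝓀[F] n R)

/-- `Γ`, the parahoric induction of `Γ_f`. -/
def padicGamma : Representation R (GL (Fin n) F) (PadicGammaV F n R) :=
  parahoricInd (finGamma 𝓀[F] n R)

variable [TopologicalSpace F]

/-- The subspace `I Γ`, with `I` the annihilator of `P` in the global Hecke algebra of `G`, where
the Haar measure gives `K¹` volume `1`. -/
def padicAnnGamma : Submodule R (PadicGammaV F n R) :=
  heckeAnnSpan (proRadical F n) (padicP F n R) (padicGamma F n R)

variable [IsNonarchimedeanLocalField F]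

/-- `Q = Γ / I Γ`. -/
def padicQ : Representation R (GL (Fin n) F) (PadicGammaV F n R ⧸ padicAnnGamma F n R) :=
  (padicGamma F n R).quotient (padicAnnGamma F n R) (heckeAnnSpan_stable _ _ _)

/-- The quotient map `Γ → Q`. -/
def padicQuotientMap : (padicGamma F n R).IntertwiningMap (padicQ F n R) :=
  quotientMap (padicGamma F n R) (padicAnnGamma F n R) (heckeAnnSpan_stable _ _ _)

end Padic

end ParahoricGen

end

noncomputable section

namespace ParahoricGen

section Single

variable {R : Type*} [CommRing R] {H G : Type*} [Group H] [Group G]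
variable {V : Type*} [AddCommGroup V] [Module R V]

open Classical in
/-- The element of `ind_H^G ρ` supported on `H` with value `v` at `1`. -/
def cIndSingle (φ : H →* G) (hφ : Function.Injective φ) (ρ : Representation R H V) :
    V →ₗ[R] cIndV φ ρ where
  toFun v := ⟨fun g => if h : ∃ a, φ a = g then ρ h.choose v else 0, by
    refine ⟨fun h g => ?_, {1}, fun g hg => ?_⟩
    · by_cases hg : ∃ a, φ a = g
      · have hg' : ∃ a, φ a = φ h * g := ⟨h * hg.choose, by rw [map_mul, hg.choose_spec]⟩
        have e : hg'.choose = h * hg.choose :=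
          hφ (by rw [hg'.choose_spec, map_mul, hg.choose_spec])
        simp only [dif_pos hg, dif_pos hg', e, map_mul, Module.End.mul_apply]
      · have hg' : ¬ ∃ a, φ a = φ h * g := fun ⟨a, ha⟩ =>
          hg ⟨h⁻¹ * a, by rw [map_mul, ha, map_inv, inv_mul_cancel_left]⟩
        simp only [dif_neg hg, dif_neg hg', map_zero]
    · by_cases h : ∃ a, φ a = g
      · exact ⟨h.choose, 1, by simp, by rw [mul_one, h.choose_spec]⟩
      · simp [h] at hg⟩
  map_add' v w := by
    ext g
    by_cases h : ∃ a, φ a = g <;> simp [h]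
  map_smul' r v := by
    ext g
    by_cases h : ∃ a, φ a = g <;> simp [h]

theorem cIndSingle_apply_map (φ : H →* G) (hφ : Function.Injective φ) (ρ : Representation R H V)
    (v : V) (a : H) : (cIndSingle φ hφ ρ v).1 (φ a) = ρ a v := by
  have h : ∃ b, φ b = φ a := ⟨a, rfl⟩
  have e : h.choose = a := hφ h.choose_spec
  simp only [cIndSingle, LinearMap.coe_mk, AddHom.coe_mk, dif_pos h, e]

theorem cIndSingle_apply_of_notMem (φ : H →* G) (hφ : Function.Injective φ)
    (ρ : Representation R H V) (v : V) {g : G} (hg : ∀ a, φ a ≠ g) :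
    (cIndSingle φ hφ ρ v).1 g = 0 := by
  have h : ¬ ∃ b, φ b = g := fun ⟨b, hb⟩ => hg b hb
  simp only [cIndSingle, LinearMap.coe_mk, AddHom.coe_mk, dif_neg h]

/-- A `G`-stable subspace of `ind_H^G ρ` that contains the functions supported on `H` with value
at `1` in `N` contains all functions with values in `N`. -/
theorem mem_of_cIndSingle_mem (φ : H →* G) (hφ : Function.Injective φ)
    (ρ : Representation R H V) (N : Submodule R V) (X : Submodule R (cIndV φ ρ))
    (hX : ∀ g, X ≤ X.comap (cInd φ ρ g)) (hN : ∀ v ∈ N, cIndSingle φ hφ ρ v ∈ X)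
    (f : cIndV φ ρ) (hf : ∀ g, f.1 g ∈ N) : f ∈ X := by
  classical
  obtain ⟨s, hs⟩ := f.2.2
  induction s using Finset.induction_on generalizing f with
  | empty =>
    have : f = 0 := by
      ext g
      by_contra h
      obtain ⟨_, x, hx, _⟩ := hs g h
      simp at hx
    exact this ▸ X.zero_mem
  | insert x s _ ih =>
    set d := cInd φ ρ x⁻¹ (cIndSingle φ hφ ρ (f.1 x)) with hd
    have hdX : d ∈ X := hX _ (hN _ (hf x))
    have hd_on : ∀ a, d.1 (φ a * x) = f.1 (φ a * x) := fun a => by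
      change (cIndSingle φ hφ ρ (f.1 x)).1 (φ a * x * x⁻¹) = _
      rw [mul_inv_cancel_right, cIndSingle_apply_map, f.2.1]
    have hd_off : ∀ g, (∀ a, g ≠ φ a * x) → d.1 g = 0 := fun g hg => by
      refine cIndSingle_apply_of_notMem φ hφ ρ _ fun a ha => hg a ?_
      rw [ha, inv_mul_cancel_right]
    have key : f - d ∈ X := by
      refine ih (f - d) (fun g => ?_) fun g hg => ?_
      · by_cases h : ∃ a, g = φ a * x
        · obtain ⟨a, rfl⟩ := h
          change f.1 _ - d.1 _ ∈ N
          rw [hd_on, sub_self]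
          exact N.zero_mem
        · push Not at h
          change f.1 _ - d.1 _ ∈ N
          rw [hd_off g h, sub_zero]
          exact hf g
      · have hne : ∀ a, g ≠ φ a * x := by
          rintro a rfl
          refine hg ?_
          change f.1 _ - d.1 _ = 0
          rw [hd_on, sub_self]
        have hfg : f.1 g ≠ 0 := fun h0 => hg (by
          change f.1 _ - d.1 _ = 0
          rw [hd_off g hne, h0, sub_zero])
        obtain ⟨a, y, hy, e⟩ := hs g hfg
        rcases Finset.mem_insert.1 hy with rfl | hy
        · exact absurd e (hne a)
        · exact ⟨a, y, hy, e⟩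
    simpa using X.add_mem key hdX

/-- Functions in a compactly induced representation are right invariant under a finite
intersection of conjugates of any subgroup acting trivially on the inducing representation. -/
theorem exists_finset_right_invariant (φ : H →* G) (ρ : Representation R H V) (L : Subgroup G)
    (hL : ∀ g ∈ L, ∃ h, φ h = g ∧ ρ h = 1) (f : cIndV φ ρ) :
    ∃ s : Finset G, ∀ u, (∀ x ∈ s, x * u * x⁻¹ ∈ L) → cInd φ ρ u f = f := by
  obtain ⟨s, hs⟩ := f.2.2
  have aux : ∀ u, (∀ x ∈ s, x * u * x⁻¹ ∈ L) → ∀ g, f.1 g ≠ 0 → f.1 (g * u) = f.1 g := by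
    intro u hu g hg
    obtain ⟨a, x, hx, rfl⟩ := hs g hg
    obtain ⟨h, hh, hρ⟩ := hL _ (hu x hx)
    have : φ a * x * u = φ a * (φ h * x) := by rw [hh]; group
    rw [this, f.2.1, f.2.1, f.2.1, hρ, Module.End.one_apply]
  refine ⟨s, fun u hu => ?_⟩
  ext g
  change f.1 (g * u) = f.1 g
  by_cases hg : f.1 g = 0
  · by_contra hne
    have h := aux u⁻¹ (fun x hx => by
      have := L.inv_mem (hu x hx)
      convert this using 1
      group) (g * u) (by rw [hg] at hne; exact hne)
    rw [mul_inv_cancel_right] at h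
    exact hne h.symm
  · exact aux u hu g hg

end Single

section Haar

variable {R : Type*} [Field R] {G : Type*} [Group G]
variable {V W : Type*} [AddCommGroup V] [Module R V] [AddCommGroup W] [Module R W]

theorem apply_out_eq {G X : Type*} [Group G] {U : Subgroup G} {φ : G → X}
    (hU : ∀ u ∈ U, ∀ g, φ (g * u) = φ g) (g : G) :
    φ (g : G ⧸ U).out = φ g := by
  obtain ⟨u, hu⟩ := QuotientGroup.mk_out_eq_mul U g
  rw [hu, hU _ u.2]

/-- The Haar integral may be computed with any sufficiently small subgroup. -/
theorem haarIntegral_eq_of_le (U₀ : Subgroup G) (φ : G → V) (U : Subgroup G) (hUU₀ : U ≤ U₀)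
    (hU : ∀ u ∈ U, ∀ g, φ (g * u) = φ g) (hidx : ((U.relIndex U₀ : ℕ) : R) ≠ 0)
    (hfin : (Function.support fun x : G ⧸ U => φ x.out).Finite) :
    haarIntegral R U₀ φ = ((U.relIndex U₀ : ℕ) : R)⁻¹ • ∑ᶠ x : G ⧸ U, φ x.out := by
  set S := rightStab U₀ φ with hS
  have hUS : U ≤ S := fun u hu => ⟨hUU₀ hu, hU u hu⟩
  have hSU₀ : S ≤ U₀ := fun u hu => hu.1
  have hmul := Subgroup.relIndex_mul_relIndex U S U₀ hUS hSU₀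
  have hne : (U.relIndex S : R) ≠ 0 ∧ (S.relIndex U₀ : R) ≠ 0 := by
    rw [← hmul, Nat.cast_mul] at hidx
    exact ⟨left_ne_zero_of_mul hidx, right_ne_zero_of_mul hidx⟩
  have hfinite : Finite (S ⧸ U.subgroupOf S) := by
    refine Nat.finite_of_card_ne_zero fun h0 => hne.1 ?_
    have : U.relIndex S = 0 := h0
    rw [this, Nat.cast_zero]
  let E := Subgroup.quotientEquivProdOfLE hUS
  have hEφ : ∀ x : G ⧸ U, φ x.out = φ (E x).1.out := by
    intro x
    obtain ⟨g, rfl⟩ := QuotientGroup.mk_surjective x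
    rw [apply_out_eq hU]
    have : (E (g : G ⧸ U)).1 = (g : G ⧸ S) := rfl
    rw [this, apply_out_eq (U := S) fun u hu => hu.2]
  have hsum : ∑ᶠ x : G ⧸ U, φ x.out = (U.relIndex S) • ∑ᶠ x : G ⧸ S, φ x.out := by
    have h1 : ∑ᶠ x : G ⧸ U, φ x.out = ∑ᶠ y : (G ⧸ S) × (S ⧸ U.subgroupOf S), φ y.1.out :=
      finsum_eq_of_bijective E E.bijective hEφ
    have hsupp : (Function.support fun y : (G ⧸ S) × (S ⧸ U.subgroupOf S) => φ y.1.out).Finite := by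
      refine (hfin.image E).subset fun y hy => ⟨E.symm y, ?_, E.apply_symm_apply y⟩
      rw [Function.mem_support, hEφ, E.apply_symm_apply]
      exact hy
    have hsupp' : (Function.support fun x : G ⧸ S => φ x.out).Finite := by
      refine (hsupp.image Prod.fst).subset fun x hx => ⟨(x, ((1 : S) : S ⧸ U.subgroupOf S)), hx, rfl⟩
    rw [h1, finsum_curry _ hsupp, smul_finsum' _ hsupp']
    refine finsum_congr fun x => ?_
    have := Fintype.ofFinite (S ⧸ U.subgroupOf S)
    dsimp only
    rw [finsum_eq_sum_of_fintype, Finset.sum_const, Finset.card_univ, ← Nat.card_eq_fintype_card]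
    rfl
  rw [haarIntegral_eq U₀ φ rfl, ← hS, hsum, ← Nat.cast_smul_eq_nsmul R, smul_smul, ← hmul]
  congr 1
  push_cast
  field_simp [hne.1, hne.2]

/-- The action of the Hecke algebra commutes with intertwining maps, on vectors where it can be
computed with a common subgroup. -/
theorem heckeAction_intertwining (U₀ : Subgroup G) (ρ : Representation R G V)
    (σ : Representation R G W) (T : ρ.IntertwiningMap σ) (f : G → R) (v : V) (U : Subgroup G)
    (hUU₀ : U ≤ U₀) (hidx : ((U.relIndex U₀ : ℕ) : R) ≠ 0)
    (hf : ∀ u ∈ U, ∀ g, f (g * u) = f g) (hv : ∀ u ∈ U, ρ u v = v)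
    (hfin : (Function.support fun x : G ⧸ U => f x.out).Finite) :
    T (heckeAction U₀ ρ f v) = heckeAction U₀ σ f (T v) := by
  have h1 : ∀ u ∈ U, ∀ g, f (g * u) • ρ (g * u) v = f g • ρ g v := fun u hu g => by
    rw [hf u hu, map_mul, Module.End.mul_apply, hv u hu]
  have h2 : ∀ u ∈ U, ∀ g, f (g * u) • σ (g * u) (T v) = f g • σ g (T v) := fun u hu g => by
    rw [← T.isIntertwining, ← T.isIntertwining, ← map_smul, h1 u hu, map_smul]
  have hs1 : (Function.support fun x : G ⧸ U => f x.out • ρ x.out v).Finite :=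
    hfin.subset (Function.support_smul_subset_left _ _)
  have hs2 : (Function.support fun x : G ⧸ U => f x.out • σ x.out (T v)).Finite :=
    hfin.subset (Function.support_smul_subset_left _ _)
  unfold heckeAction
  rw [haarIntegral_eq_of_le U₀ (fun g => f g • ρ g v) U hUU₀ h1 hidx hs1,
    haarIntegral_eq_of_le U₀ (fun g => f g • σ g (T v)) U hUU₀ h2 hidx hs2, map_smul]
  congr 1
  have := (T.toLinearMap.toAddMonoidHom).map_finsum hs1
  refine this.trans (finsum_congr fun x => ?_)
  change T _ = _
  rw [map_smul, T.isIntertwining]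

end Haar

theorem sum_smul_cInd_apply {R : Type*} [CommRing R] {H G : Type*} [Group H] [Group G]
    {V : Type*} [AddCommGroup V] [Module R V] (φ : H →* G) (ρ : Representation R H V)
    {ι : Type*} (t : Finset ι) (c : ι → R) (x : ι → G) (f : cIndV φ ρ) (y : G) :
    (∑ i ∈ t, c i • cInd φ ρ (x i) f).1 y = ∑ i ∈ t, c i • f.1 (y * x i) := by
  rw [← Submodule.subtype_apply, map_sum, Finset.sum_apply]
  rfl

section Cogeneration

variable {R : Type*} [Field R] {G : Type*} [Group G] [Fintype G]
variable {V : Type*} [AddCommGroup V] [Module R V]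

/-- The element `∑ z(g) g` of the group algebra. -/
def groupAlgebraOf (z : G → R) : MonoidAlgebra R G := ∑ g, MonoidAlgebra.single g (z g)

theorem asAlgebraHom_groupAlgebraOf (ρ : Representation R G V) (z : G → R) (v : V) :
    ρ.asAlgebraHom (groupAlgebraOf z) v = ∑ g, z g • ρ g v := by
  simp [groupAlgebraOf, map_sum, LinearMap.sum_apply, Representation.asAlgebraHom_single]

theorem groupAlgebraOf_mem_groupAnn_iff (π : Representation R G V) (z : G → R) :
    groupAlgebraOf z ∈ groupAnn π ↔ ∀ v, ∑ g, z g • π g v = 0 := by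
  rw [groupAnn, RingHom.mem_ker, LinearMap.ext_iff]
  exact forall_congr' fun v => by
    rw [← asAlgebraHom_groupAlgebraOf]
    rfl

theorem exists_groupAlgebraOf_eq {R : Type*} [Field R] {G : Type*} [Fintype G]
    (z : MonoidAlgebra R G) : ∃ f : G → R, groupAlgebraOf f = z := by
  induction z using MonoidAlgebra.induction_linear with
  | zero => exact ⟨0, by simp [groupAlgebraOf]⟩
  | add x y hx hy =>
    obtain ⟨f, rfl⟩ := hx
    obtain ⟨g, rfl⟩ := hy
    exact ⟨f + g, by simp [groupAlgebraOf, Finset.sum_add_distrib]⟩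
  | single a r =>
    classical
    refine ⟨Pi.single a r, ?_⟩
    rw [groupAlgebraOf, Finset.sum_eq_single a (fun b _ hb => by simp [hb]) (by simp),
      Pi.single_eq_same]

/-- Let `ρ` be a representation with a dual basis over the group algebra. A vector all of whose
translates are killed by the `B`-invariant functionals lies in `A ρ`, where `A` is the annihilator of
`ind_B^G 1`. -/
theorem mem_groupAnnSpan_of_invariant_functionals (B : Subgroup G) (ρ : Representation R G V)
    {ι : Type*} (β : ι → V →ₗ[R] (G → R)) (δ : ι → V)
    (hβ : ∀ i y v g, β i (ρ y v) g = β i v (y⁻¹ * g))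
    (hδ : ∀ v, ∃ t : Finset ι, ∑ i ∈ t, ∑ g, β i v g • ρ g (δ i) = v) (w : V)
    (hw : ∀ a : V →ₗ[R] R, (∀ b ∈ B, ∀ v, a (ρ b v) = a v) → ∀ y, a (ρ y w) = 0) :
    w ∈ groupAnnSpan (cInd B.subtype (Representation.trivial R B R)) ρ := by
  obtain ⟨t, ht⟩ := hδ w
  rw [← ht]
  refine Submodule.sum_mem _ fun i _ => Submodule.subset_span
    ⟨groupAlgebraOf (β i w), ?_, δ i, asAlgebraHom_groupAlgebraOf _ _ _⟩
  rw [groupAlgebraOf_mem_groupAnn_iff]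
  intro h
  ext y
  let a : V →ₗ[R] R :=
    { toFun := fun v => ∑ g, β i v g * h.1 g
      map_add' := fun v v' => by simp [add_mul, Finset.sum_add_distrib]
      map_smul' := fun r v => by simp [Finset.mul_sum, mul_assoc] }
  have ha : ∀ y v, a (ρ y v) = ∑ g, β i v g * h.1 (y * g) := fun y v => by
    change ∑ g, β i (ρ y v) g * h.1 g = _
    refine (Fintype.sum_equiv (Equiv.mulLeft y) _ _ fun g => ?_).symm
    simp [hβ]
  have := hw a (fun b hb v => by
    rw [ha]
    refine Finset.sum_congr rfl fun g _ => ?_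
    have := h.2.1 ⟨b, hb⟩ g
    simp only [Subgroup.subtype_apply, Representation.isTrivial_def] at this
    exact congrArg _ this) y
  rw [ha] at this
  rw [sum_smul_cInd_apply]
  exact this

end Cogeneration

section DualBasis

variable {R : Type*} [Field R] {G M : Type*} [Group G] [Group M]
variable {J : Subgroup G} {U : Subgroup M}

/-- The representation `ind_J^G infl_M^J ind_U^M χ`. -/
abbrev inflInd (q : J →* M) (χ : U →* Rˣ) :
    Representation R G (cIndV J.subtype ((cInd U.subtype (charRep χ)).comp q)) :=
  cInd J.subtype ((cInd U.subtype (charRep χ)).comp q)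

/-- The vector of `ind_J^G infl_M^J ind_U^M χ` supported on the preimage of `U` in `J`. -/
def inflIndGenerator (q : J →* M) (χ : U →* Rˣ) :
    cIndV J.subtype ((cInd U.subtype (charRep χ)).comp q) :=
  cIndSingle J.subtype J.subtype_injective _
    (cIndSingle U.subtype U.subtype_injective (charRep χ) 1)

/-- The coordinate of `ind_J^G infl_M^J ind_U^M χ` with respect to the generator. -/
def inflIndCoord (q : J →* M) (χ : U →* Rˣ) :
    cIndV J.subtype ((cInd U.subtype (charRep χ)).comp q) →ₗ[R] (G → R) where
  toFun f g := (Nat.card (U.comap q) : R)⁻¹ * (f.1 g⁻¹).1 1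
  map_add' f f' := by
    ext g
    exact mul_add _ _ _
  map_smul' r f := by
    ext g
    exact mul_left_comm _ _ _

theorem inflIndCoord_equivariant (q : J →* M) (χ : U →* Rˣ) (y : G)
    (f : cIndV J.subtype ((cInd U.subtype (charRep χ)).comp q)) (g : G) :
    inflIndCoord q χ (inflInd q χ y f) g = inflIndCoord q χ f (y⁻¹ * g) := by
  change _ * (f.1 (g⁻¹ * y)).1 1 = _ * (f.1 (y⁻¹ * g)⁻¹).1 1
  rw [mul_inv_rev, inv_inv]

theorem apply_mul_one (q : J →* M) (χ : U →* Rˣ)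
    (f : cIndV J.subtype ((cInd U.subtype (charRep χ)).comp q)) (j : J) (g : G) :
    (f.1 (j * g)).1 1 = (f.1 g).1 (q j) := by
  have := congrArg (fun h => h.1 1) (f.2.1 j g)
  refine this.trans ?_
  change (f.1 g).1 (1 * q j) = _
  rw [one_mul]

theorem sum_inflIndCoord_smul [Fintype G] (q : J →* M) (hq : Function.Surjective q) (χ : U →* Rˣ)
    (hcard : (Nat.card (U.comap q) : R) ≠ 0)
    (f : cIndV J.subtype ((cInd U.subtype (charRep χ)).comp q)) :
    ∑ g, inflIndCoord q χ f g • inflInd q χ g (inflIndGenerator q χ) = f := by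
  classical
  have hone : ∀ f₁ f₂ : cIndV J.subtype ((cInd U.subtype (charRep χ)).comp q),
      (∀ y, (f₁.1 y).1 1 = (f₂.1 y).1 1) → f₁ = f₂ := by
    intro f₁ f₂ h
    ext y m
    obtain ⟨j, rfl⟩ := hq m
    rw [← apply_mul_one, ← apply_mul_one, h]
  refine hone _ _ fun y => ?_
  rw [sum_smul_cInd_apply]
  have hsum : (∑ g, inflIndCoord q χ f g • (inflIndGenerator q χ).1 (y * g)).1 1 =
      ∑ g, inflIndCoord q χ f g * ((inflIndGenerator q χ).1 (y * g)).1 1 := by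
    rw [← Submodule.subtype_apply, map_sum, Finset.sum_apply]
    rfl
  rw [hsum]
  have hterm : ∀ x, (f.1 (x⁻¹ * y)).1 1 * ((inflIndGenerator q χ).1 x).1 1 =
      if x ∈ (U.comap q).map J.subtype then (f.1 y).1 1 else 0 := by
    intro x
    by_cases hx : x ∈ J
    · have h1 : ((inflIndGenerator q χ).1 x).1 1 =
          (cIndSingle U.subtype U.subtype_injective (charRep χ) 1).1 (q ⟨x, hx⟩) := by
        have := cIndSingle_apply_map J.subtype J.subtype_injective
          ((cInd U.subtype (charRep χ)).comp q)
          (cIndSingle U.subtype U.subtype_injective (charRep χ) 1) ⟨x, hx⟩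
        refine (congrArg (fun h => h.1 1) this).trans ?_
        change (cIndSingle U.subtype U.subtype_injective (charRep χ) 1).1 (1 * q ⟨x, hx⟩) = _
        rw [one_mul]
      by_cases hU : q ⟨x, hx⟩ ∈ U
      · rw [if_pos ⟨⟨x, hx⟩, hU, rfl⟩, h1,
          show q ⟨x, hx⟩ = U.subtype ⟨_, hU⟩ from rfl, cIndSingle_apply_map]
        have h2 := apply_mul_one q χ f ⟨x, hx⟩ (x⁻¹ * y)
        rw [mul_inv_cancel_left] at h2
        have h3 := (f.1 (x⁻¹ * y)).2.1 ⟨_, hU⟩ 1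
        rw [mul_one] at h3
        rw [h2]
        refine Eq.trans ?_ h3.symm
        change _ * (χ _ : R) • (1 : R) = (χ _ : R) • _
        rw [smul_eq_mul, smul_eq_mul, mul_one, mul_comm]
        rfl
      · rw [if_neg, h1, cIndSingle_apply_of_notMem, mul_zero]
        · rintro a ha
          exact hU (ha ▸ a.2)
        · rintro ⟨j, hj, rfl⟩
          exact hU hj
    · rw [if_neg, inflIndGenerator, cIndSingle_apply_of_notMem]
      · exact mul_zero _
      · rintro a rfl
        exact hx a.2
      · rintro ⟨j, hj, rfl⟩
        exact hx j.2
  have hre : ∑ g, inflIndCoord q χ f g * ((inflIndGenerator q χ).1 (y * g)).1 1 =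
      ∑ x, (Nat.card (U.comap q) : R)⁻¹ *
        ((f.1 (x⁻¹ * y)).1 1 * ((inflIndGenerator q χ).1 x).1 1) := by
    refine Fintype.sum_equiv (Equiv.mulLeft y) _ _ fun g => ?_
    change _ * (f.1 g⁻¹).1 1 * _ = _ * ((f.1 ((y * g)⁻¹ * y)).1 1 * _)
    rw [mul_inv_rev, inv_mul_cancel_right, mul_assoc]
    rfl
  have hcardeq : (Finset.univ.filter fun x => x ∈ (U.comap q).map J.subtype).card =
      Nat.card (U.comap q) := by
    rw [Nat.card_congr ((U.comap q).equivMapOfInjective J.subtype J.subtype_injective).toEquiv,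
      Nat.card_eq_fintype_card, Fintype.card_subtype]
  rw [hre, ← Finset.mul_sum, Finset.sum_congr rfl fun x _ => hterm x, ← Finset.sum_filter,
    Finset.sum_const, hcardeq, nsmul_eq_mul, inv_mul_cancel_left₀ hcard]

end DualBasis

theorem mem_groupAnnSpan_directSum {R : Type*} [Field R] {G : Type*} [Group G] [Fintype G]
    (B : Subgroup G) {ι : Type*} {V : ι → Type*} [∀ i, AddCommGroup (V i)] [∀ i, Module R (V i)]
    (ρ : ∀ i, Representation R G (V i)) (β : ∀ i, V i →ₗ[R] (G → R)) (δ : ∀ i, V i)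
    (hβ : ∀ i y v g, β i (ρ i y v) g = β i v (y⁻¹ * g))
    (hδ : ∀ i v, ∑ g, β i v g • ρ i g (δ i) = v) (w : DirectSum ι V)
    (hw : ∀ a : DirectSum ι V →ₗ[R] R, (∀ b ∈ B, ∀ v, a (Representation.directSum ρ b v) = a v) →
      ∀ y, a (Representation.directSum ρ y w) = 0) :
    w ∈ groupAnnSpan (cInd B.subtype (Representation.trivial R B R))
      (Representation.directSum ρ) := by
  classical
  refine mem_groupAnnSpan_of_invariant_functionals B (Representation.directSum ρ)
    (fun i => β i ∘ₗ DirectSum.component R ι V i) (fun i => DirectSum.lof R ι V i (δ i))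
    (fun i y v g => hβ i y (v i) g) (fun v => ⟨DFinsupp.support v, ?_⟩) w hw
  conv_rhs => rw [← DirectSum.sum_support_of v]
  refine Finset.sum_congr rfl fun i _ => ?_
  have h : ∀ g, Representation.directSum ρ g (DirectSum.lof R ι V i (δ i)) =
      DirectSum.lof R ι V i (ρ i g (δ i)) := fun g => DirectSum.lmap_lof _ _ _
  refine Eq.trans ?_ (congrArg (DirectSum.lof R ι V i) (hδ i (v i)))
  rw [map_sum]
  refine Finset.sum_congr rfl fun g _ => ?_
  rw [map_smul, h]
  rfl

section FiniteGamma

theorem index_monotone {n : ℕ} (c : Composition n) : Monotone c.index := by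
  intro i j hij
  by_contra h
  push Not at h
  have h1 := c.lt_sizeUpTo_index_succ j
  have h2 := c.sizeUpTo_index_le i
  have h3 : c.sizeUpTo (c.index j).succ ≤ c.sizeUpTo (c.index i) := c.monotone_sizeUpTo h
  have : (i : ℕ) ≤ j := hij
  omega

theorem pow_eq_zero_of_strictlyUpperTriangular {k : Type*} [Field k] {n : ℕ}
    {N : Matrix (Fin n) (Fin n) k} (hN : N.BlockTriangular id) (h0 : ∀ i, N i i = 0) :
    N ^ n = 0 := by
  have h1 := Matrix.charpoly_of_isUpperTriangular N hN
  have h2 := Matrix.aeval_self_charpoly N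
  simpa [h1, h0] using h2

variable {k : Type*} [Field k] {n : ℕ}

theorem leviProj_surjective {α : Type*} [LinearOrder α] (b : Fin n → α) :
    Function.Surjective (leviProj k b) := by
  intro m
  refine ⟨⟨m.1, fun i j h => m.2 i j h.ne'⟩, ?_⟩
  ext i j
  change (if b i = b j then m.1.1 i j else 0) = m.1.1 i j
  split_ifs with h
  · rfl
  · exact (m.2 i j h).symm

theorem isPGroup_comap_leviUnip {p : ℕ} [Fact p.Prime] [CharP k p] (c : Composition n) :
    IsPGroup p ((leviUnip k c.index).comap (leviProj k c.index)) := by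
  rintro ⟨⟨g, hg⟩, hgU⟩
  have hup : (g : Matrix (Fin n) (Fin n) k).BlockTriangular id := by
    intro i j hij
    rcases (index_monotone c hij.le).lt_or_eq with h | h
    · exact hg h
    · have := hgU.1 hij
      change (if c.index i = c.index j then g.1 i j else 0) = 0 at this
      have h' : c.index i = c.index j := h.symm
      simpa only [if_pos h'] using this
  have hdiag : ∀ i, (g : Matrix (Fin n) (Fin n) k) i i = 1 := by
    intro i
    have := hgU.2 i
    change (if c.index i = c.index i then g.1 i i else 0) = 1 at this
    rwa [if_pos rfl] at this
  refine ⟨n, ?_⟩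
  ext : 3
  set N : Matrix (Fin n) (Fin n) k := (g : Matrix (Fin n) (Fin n) k) - 1 with hN
  have hNn : N ^ n = 0 := pow_eq_zero_of_strictlyUpperTriangular
    (hup.sub Matrix.blockTriangular_one) fun i => by simp [hN, hdiag]
  have hgN : (g : Matrix (Fin n) (Fin n) k) = N + 1 := by simp [hN]
  change (g : Matrix (Fin n) (Fin n) k) ^ p ^ n = 1
  rcases isEmpty_or_nonempty (Fin n) with he | he
  · exact Subsingleton.elim _ _
  have : CharP (Matrix (Fin n) (Fin n) k) p := inferInstance
  rw [hgN, add_pow_char_pow_of_commute _ _ (Commute.one_right N), one_pow,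
    pow_eq_zero_of_le (Nat.lt_pow_self (Fact.out : p.Prime).one_lt).le hNn, zero_add]

theorem card_comap_leviUnip_ne_zero [Finite k] {p : ℕ} [Fact p.Prime] [CharP k p] {R : Type*}
    [Field R] (hp : (p : R) ≠ 0) (c : Composition n) :
    (Nat.card ((leviUnip k c.index).comap (leviProj k c.index)) : R) ≠ 0 := by
  obtain ⟨m, hm⟩ := IsPGroup.iff_card.1 (isPGroup_comap_leviUnip (k := k) (p := p) c)
  rw [hm, Nat.cast_pow]
  exact pow_ne_zero _ hp

/-- `Q_f` is cogenerated by `P_f`. -/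
theorem mem_finAnnGamma_of_invariant_functionals [Finite k] {p : ℕ} [Fact p.Prime] [CharP k p]
    {R : Type*} [Field R] (hp : (p : R) ≠ 0) (w : FinGammaV k n R)
    (hw : ∀ a : FinGammaV k n R →ₗ[R] R,
      (∀ b ∈ borel k n, ∀ v, a (finGamma k n R b v) = a v) → ∀ y, a (finGamma k n R y w) = 0) :
    w ∈ finAnnGamma k n R := by
  have := Fintype.ofFinite (GL (Fin n) k)
  exact mem_groupAnnSpan_directSum (borel k n) (gammaSummand k n R)
    (fun i => inflIndCoord (leviProj k i.1.index) i.2.1)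
    (fun i => inflIndGenerator (leviProj k i.1.index) i.2.1)
    (fun i => inflIndCoord_equivariant (leviProj k i.1.index) i.2.1)
    (fun i => sum_inflIndCoord_smul _ (leviProj_surjective _) _
      (card_comap_leviUnip_ne_zero hp i.1)) w hw

end FiniteGamma

section Congruence

variable {O : Type*} [CommRing O] {n : ℕ}

/-- The congruence subgroup of `GL_n(O)` of level `I`. -/
def congruenceSubgroup (n : ℕ) (I : Ideal O) : Subgroup (GL (Fin n) O) :=
  (Matrix.GeneralLinearGroup.map (Ideal.Quotient.mk I)).ker

theorem mem_congruenceSubgroup_iff {I : Ideal O} {g : GL (Fin n) O} :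
    g ∈ congruenceSubgroup n I ↔
      ∀ i j, (g : Matrix (Fin n) (Fin n) O) i j - (1 : Matrix (Fin n) (Fin n) O) i j ∈ I := by
  rw [congruenceSubgroup, MonoidHom.mem_ker, Units.ext_iff, ← Matrix.ext_iff]
  refine forall_congr' fun i => forall_congr' fun j => ?_
  rw [← Ideal.Quotient.eq]
  refine Eq.congr rfl ?_
  by_cases h : i = j
  · subst h
    simp
  · simp [Matrix.one_apply_ne h]

theorem congruenceSubgroup_mono {I J : Ideal O} (h : I ≤ J) :
    congruenceSubgroup n I ≤ congruenceSubgroup n J := fun _ hg =>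
  mem_congruenceSubgroup_iff.2 fun i j => h (mem_congruenceSubgroup_iff.1 hg i j)

instance (I : Ideal O) : (congruenceSubgroup n I).Normal := by
  unfold congruenceSubgroup
  infer_instance

theorem pow_mem_congruenceSubgroup {I J : Ideal O} {p : ℕ} (hp : (p : O) ∈ I) (hJI : J ≤ I)
    {g : GL (Fin n) O} (hg : g ∈ congruenceSubgroup n J) :
    g ^ p ∈ congruenceSubgroup n (J * I) := by
  rw [mem_congruenceSubgroup_iff]
  intro i j
  have h1 : ((g ^ p : GL (Fin n) O) : Matrix (Fin n) (Fin n) O) - 1 =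
      ((g : Matrix (Fin n) (Fin n) O) - 1) *
        ∑ i ∈ Finset.range p, (g : Matrix (Fin n) (Fin n) O) ^ i := by
    rw [mul_geom_sum, Units.val_pow_eq_pow_val]
  have h2 : ∀ i j, (∑ m ∈ Finset.range p, (g : Matrix (Fin n) (Fin n) O) ^ m) i j ∈ I := by
    have hg1 : (Ideal.Quotient.mk I).mapMatrix (g : Matrix (Fin n) (Fin n) O) = 1 :=
      congrArg Units.val (MonoidHom.mem_ker.1 (congruenceSubgroup_mono hJI hg))
    have : (Ideal.Quotient.mk I).mapMatrix
        (∑ m ∈ Finset.range p, (g : Matrix (Fin n) (Fin n) O) ^ m) = 0 := by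
      rw [map_sum]
      simp only [map_pow, hg1, one_pow, Finset.sum_const, Finset.card_range, nsmul_eq_mul, mul_one]
      rw [← map_natCast ((Ideal.Quotient.mk I).mapMatrix (m := Fin n)), ← Matrix.diagonal_natCast]
      ext i j
      by_cases h : i = j
      · subst h
        simpa using Ideal.Quotient.eq_zero_iff_mem.2 hp
      · simp [Matrix.diagonal_apply_ne _ h]
    intro i j
    rw [← Ideal.Quotient.eq_zero_iff_mem]
    exact congrFun (congrFun this i) j
  rw [← Matrix.sub_apply, h1, Matrix.mul_apply]
  exact Submodule.sum_mem _ fun l _ =>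
    Ideal.mul_mem_mul (mem_congruenceSubgroup_iff.1 hg i l) (h2 l j)

theorem pow_pow_mem_congruenceSubgroup {I : Ideal O} {p : ℕ} (hp : (p : O) ∈ I)
    {g : GL (Fin n) O} (hg : g ∈ congruenceSubgroup n I) (m : ℕ) :
    g ^ p ^ m ∈ congruenceSubgroup n (I ^ (m + 1)) := by
  induction m with
  | zero => simpa using hg
  | succ m ih =>
    rw [pow_succ p, pow_mul, pow_succ I]
    exact pow_mem_congruenceSubgroup hp (Ideal.pow_le_self (by omega)) ih

theorem exists_relIndex_congruenceSubgroup_eq_pow {I : Ideal O} {p : ℕ} [Fact p.Prime]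
    (hp : (p : O) ∈ I) (m : ℕ) [Finite (O ⧸ I ^ (m + 1))] :
    ∃ a, (congruenceSubgroup n (I ^ (m + 1))).relIndex (congruenceSubgroup n I) = p ^ a := by
  set L := (congruenceSubgroup n (I ^ (m + 1))).subgroupOf (congruenceSubgroup n I) with hL
  have hfin : Finite (congruenceSubgroup n I ⧸ L) := by
    have : Finite (GL (Fin n) (O ⧸ I ^ (m + 1))) := inferInstance
    have : (congruenceSubgroup n (I ^ (m + 1))).FiniteIndex := by
      unfold congruenceSubgroup
      infer_instance
    have : L.FiniteIndex := inferInstance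
    exact Subgroup.finite_quotient_of_finiteIndex
  have hP : IsPGroup p (congruenceSubgroup n I ⧸ L) := by
    intro x
    obtain ⟨g, rfl⟩ := QuotientGroup.mk_surjective x
    refine ⟨m, ?_⟩
    rw [← QuotientGroup.mk_pow, QuotientGroup.eq_one_iff]
    exact pow_pow_mem_congruenceSubgroup hp g.2 m
  exact IsPGroup.iff_card.1 hP

end Congruence

section LocalField

open Topology

variable (F : Type*) [Field F] [ValuativeRel F] [TopologicalSpace F] [IsNonarchimedeanLocalField F]
variable (n : ℕ)

theorem t2Space_localField : T2Space F := by
  let := IsTopologicalAddGroup.rightUniformSpace F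
  have := isUniformAddGroup_of_addCommGroup (G := F)
  infer_instance

theorem isOpen_integers : IsOpen {x : F | ValuativeRel.valuation F x ≤ 1} := by
  let := IsTopologicalAddGroup.rightUniformSpace F
  have := isUniformAddGroup_of_addCommGroup (G := F)
  exact Valued.isOpen_integer F

theorem inclK_injective {F : Type*} [Field F] [ValuativeRel F] {n : ℕ} :
    Function.Injective (inclK F n) := fun a b h => by
  ext i j
  exact congrArg (fun g : GL (Fin n) F => (g : Matrix (Fin n) (Fin n) F) i j) h

theorem continuous_inclK (F : Type*) [Field F] [ValuativeRel F] [TopologicalSpace F] (n : ℕ) :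
    Continuous (inclK F n) := by
  refine Continuous.units_map _ ?_
  exact continuous_id.matrix_map continuous_subtype_val

theorem compactSpace_GL_integers : CompactSpace (GL (Fin n) 𝒪[F]) := by
  have := t2Space_localField F
  have : CompactSpace (Matrix (Fin n) (Fin n) 𝒪[F]) :=
    inferInstanceAs (CompactSpace (Fin n → Fin n → 𝒪[F]))
  infer_instance

theorem t2Space_GL : T2Space (GL (Fin n) F) := by
  have := t2Space_localField F
  have : T2Space (Matrix (Fin n) (Fin n) F) := inferInstanceAs (T2Space (Fin n → Fin n → F))
  infer_instance

theorem exists_inclK_eq {F : Type*} [Field F] [ValuativeRel F] {n : ℕ} (g : GL (Fin n) F)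
    (h : ∀ i j, (g : Matrix (Fin n) (Fin n) F) i j ∈ 𝒪[F])
    (h' : ∀ i j, ((g⁻¹ : GL (Fin n) F) : Matrix (Fin n) (Fin n) F) i j ∈ 𝒪[F]) :
    ∃ κ, inclK F n κ = g := by
  have hinj : Function.Injective ((𝒪[F]).subtype.mapMatrix (m := Fin n)) := fun A B e => by
    ext i j
    exact congrFun (congrFun e i) j
  let A : Matrix (Fin n) (Fin n) 𝒪[F] := Matrix.of fun i j => ⟨_, h i j⟩
  let B : Matrix (Fin n) (Fin n) 𝒪[F] := Matrix.of fun i j => ⟨_, h' i j⟩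
  have hA : (𝒪[F]).subtype.mapMatrix A = g := rfl
  have hB : (𝒪[F]).subtype.mapMatrix B = (g⁻¹ : GL (Fin n) F) := rfl
  refine ⟨⟨A, B, hinj ?_, hinj ?_⟩, ?_⟩
  · rw [map_mul, hA, hB, map_one, ← Units.val_mul, mul_inv_cancel, Units.val_one]
  · rw [map_mul, hA, hB, map_one, ← Units.val_mul, inv_mul_cancel, Units.val_one]
  · ext i j
    rfl

theorem isOpen_range_inclK : IsOpen (Set.range (inclK F n)) := by
  have e : Set.range (inclK F n) = ⋂ i, ⋂ j,
      ((fun g : GL (Fin n) F => (g : Matrix (Fin n) (Fin n) F) i j) ⁻¹'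
        {x : F | ValuativeRel.valuation F x ≤ 1}) ∩
      ((fun g : GL (Fin n) F => ((g⁻¹ : GL (Fin n) F) : Matrix (Fin n) (Fin n) F) i j) ⁻¹'
        {x : F | ValuativeRel.valuation F x ≤ 1}) := by
    ext g
    simp only [Set.mem_iInter, Set.mem_inter_iff, Set.mem_preimage]
    constructor
    · rintro ⟨κ, rfl⟩ i j
      exact ⟨((κ : Matrix (Fin n) (Fin n) 𝒪[F]) i j).2,
        (((κ⁻¹ : GL (Fin n) 𝒪[F]) : Matrix (Fin n) (Fin n) 𝒪[F]) i j).2⟩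
    · intro h
      exact exists_inclK_eq g (fun i j => (h i j).1) fun i j => (h i j).2
  rw [e]
  have hc : ∀ i j, Continuous fun g : GL (Fin n) F => (g : Matrix (Fin n) (Fin n) F) i j :=
    fun i j => Units.continuous_val.matrix_elem i j
  refine isOpen_iInter_of_finite fun i => isOpen_iInter_of_finite fun j => IsOpen.inter ?_ ?_
  · exact (isOpen_integers F).preimage (hc i j)
  · exact (isOpen_integers F).preimage ((hc i j).comp continuous_inv)

theorem isOpenEmbedding_inclK : IsOpenEmbedding (inclK F n) := by
  have := compactSpace_GL_integers F n
  have := t2Space_GL F n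
  exact ⟨((continuous_inclK F n).isClosedEmbedding inclK_injective).isEmbedding,
    isOpen_range_inclK F n⟩

theorem isClosed_congruenceSubgroup (I : Ideal 𝒪[F]) :
    IsClosed (congruenceSubgroup n I : Set (GL (Fin n) 𝒪[F])) := by
  have := t2Space_localField F
  have hI : IsClosed (I : Set 𝒪[F]) := IsNoetherianRing.isClosed_ideal I
  have e : (congruenceSubgroup n I : Set (GL (Fin n) 𝒪[F])) = ⋂ i, ⋂ j,
      (fun g : GL (Fin n) 𝒪[F] => (g : Matrix (Fin n) (Fin n) 𝒪[F]) i j -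
        (1 : Matrix (Fin n) (Fin n) 𝒪[F]) i j) ⁻¹' I := by
    ext g
    simp only [Set.mem_iInter, Set.mem_preimage, SetLike.mem_coe, mem_congruenceSubgroup_iff]
  rw [e]
  exact isClosed_iInter fun i => isClosed_iInter fun j => hI.preimage
    ((Units.continuous_val.matrix_elem i j).sub continuous_const)

/-- The image in `GL_n(F)` of the congruence subgroup of level `𝓂^(m+1)`. -/
def congruenceImage (F : Type*) [Field F] [ValuativeRel F] (n m : ℕ) : Subgroup (GL (Fin n) F) :=
  (congruenceSubgroup n (𝓂[F] ^ (m + 1))).map (inclK F n)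

theorem finite_quotient_maximalIdeal_pow (m : ℕ) : Finite (𝒪[F] ⧸ 𝓂[F] ^ m) := by
  have : Finite (𝒪[F] ⧸ 𝓂[F]) := inferInstanceAs (Finite 𝓀[F])
  exact Ideal.finite_quotient_pow (IsNoetherian.noetherian _) _

theorem isOpen_congruenceImage (m : ℕ) : IsOpen (congruenceImage F n m : Set (GL (Fin n) F)) := by
  have := finite_quotient_maximalIdeal_pow F (m + 1)
  have : (congruenceSubgroup n (𝓂[F] ^ (m + 1))).FiniteIndex := by
    have : Finite (GL (Fin n) (𝒪[F] ⧸ 𝓂[F] ^ (m + 1))) := inferInstance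
    unfold congruenceSubgroup
    infer_instance
  exact (isOpenEmbedding_inclK F n).isOpenMap _
    (Subgroup.isOpen_of_isClosed_of_finiteIndex _ (isClosed_congruenceSubgroup F n _))

theorem ker_redK_eq (F : Type*) [Field F] [ValuativeRel F] (n : ℕ) :
    (redK F n).ker = congruenceSubgroup n 𝓂[F] := rfl

theorem congruenceImage_le (F : Type*) [Field F] [ValuativeRel F] (n m : ℕ) :
    congruenceImage F n m ≤ proRadical F n := by
  rw [proRadical, ker_redK_eq]
  exact Subgroup.map_mono (congruenceSubgroup_mono (Ideal.pow_le_self (by omega)))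

theorem isOpen_proRadical : IsOpen (proRadical F n : Set (GL (Fin n) F)) :=
  Subgroup.isOpen_mono (congruenceImage_le F n 0) (isOpen_congruenceImage F n 0)

theorem relIndex_congruenceImage_ne_zero {R : Type*} [Field R] {p : ℕ} [Fact p.Prime]
    [CharP 𝓀[F] p] (hp : (p : R) ≠ 0) (m : ℕ) :
    (((congruenceImage F n m).relIndex (proRadical F n) : ℕ) : R) ≠ 0 := by
  have := finite_quotient_maximalIdeal_pow F (m + 1)
  have hpm : (p : 𝒪[F]) ∈ 𝓂[F] := by
    rw [← IsLocalRing.residue_eq_zero_iff, map_natCast, CharP.cast_eq_zero]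
  obtain ⟨a, ha⟩ := exists_relIndex_congruenceSubgroup_eq_pow (n := n) hpm m
  rw [congruenceImage, proRadical, ker_redK_eq,
    Subgroup.relIndex_map_map_of_injective _ _ inclK_injective, ha, Nat.cast_pow]
  exact pow_ne_zero _ hp

theorem exists_congruenceImage_subset {N : Set (GL (Fin n) F)} (hN : N ∈ 𝓝 1) :
    ∃ m, (congruenceImage F n m : Set (GL (Fin n) F)) ⊆ N := by
  have := compactSpace_GL_integers F n
  have hdir : Directed (· ⊇ ·) fun m : ℕ =>
      (congruenceSubgroup n (𝓂[F] ^ (m + 1)) : Set (GL (Fin n) 𝒪[F])) := by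
    refine directed_of_isDirected_le fun a b hab => ?_
    exact congruenceSubgroup_mono (Ideal.pow_le_pow_right (by omega))
  obtain ⟨m, hm⟩ := exists_subset_nhds_of_isCompact' (U := inclK F n ⁻¹' N) hdir
    (fun m => (isClosed_congruenceSubgroup F n _).isCompact)
    (fun m => isClosed_congruenceSubgroup F n _) (by
      intro x hx
      have hx1 : x = 1 := by
        ext i j : 2
        rw [← sub_eq_zero, ← Ideal.mem_bot,
          ← Ideal.iInf_pow_eq_bot_of_isLocalRing 𝓂[F] (Ideal.IsPrime.ne_top inferInstance),
          Ideal.mem_iInf]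
        intro m
        exact Ideal.pow_le_pow_right (Nat.le_succ m)
          (mem_congruenceSubgroup_iff.1 (Set.mem_iInter.1 hx m) i j)
      subst hx1
      exact (continuous_inclK F n).continuousAt.preimage_mem_nhds (by rwa [map_one]))
  refine ⟨m, ?_⟩
  rintro _ ⟨u, hu, rfl⟩
  exact hm hu

end LocalField

section Shear

variable {O : Type*} [CommRing O] {n : ℕ}

/-- The invertible matrix `1 + x yᵗ`, for orthogonal vectors `x` and `y`. -/
def shear (x y : Fin n → O) (h : y ⬝ᵥ x = 0) : GL (Fin n) O where
  val := 1 + Matrix.vecMulVec x y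
  inv := 1 - Matrix.vecMulVec x y
  val_inv := by
    have : Matrix.vecMulVec x y * Matrix.vecMulVec x y = 0 := by
      simp [Matrix.vecMulVec_mul_vecMulVec, h]
    rw [add_mul, mul_sub, mul_sub, this]
    simp
  inv_val := by
    have : Matrix.vecMulVec x y * Matrix.vecMulVec x y = 0 := by
      simp [Matrix.vecMulVec_mul_vecMulVec, h]
    rw [sub_mul, mul_add, mul_add, this]
    simp

end Shear

section Iwahori

variable {F : Type*} [Field F] [ValuativeRel F] {n : ℕ}

open ValuativeRel

theorem mem_maximalIdeal_iff_valuation_lt_one (x : 𝒪[F]) :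
    x ∈ 𝓂[F] ↔ valuation F x < 1 := by
  rw [IsLocalRing.mem_maximalIdeal, mem_nonunits_iff,
    Valuation.Integer.not_isUnit_iff_valuation_lt_one]

theorem inclK_shear_mul_apply (c : Fin n → 𝒪[F]) (a : Fin n) (h : Pi.single a 1 ⬝ᵥ c = 0)
    (A : GL (Fin n) F) (i j : Fin n) :
    (inclK F n (shear c (Pi.single a 1) h) * A : GL (Fin n) F).1 i j =
      A.1 i j + c i * A.1 a j := by
  have e : (inclK F n (shear c (Pi.single a 1) h)).1 =
      1 + Matrix.vecMulVec (fun i => (c i : F)) (Pi.single a 1) := by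
    ext i j
    change (((1 : Matrix (Fin n) (Fin n) 𝒪[F]) i j + c i * (Pi.single a 1 : Fin n → 𝒪[F]) j :
      𝒪[F]) : F) = (1 : Matrix (Fin n) (Fin n) F) i j + c i * (Pi.single a 1 : Fin n → F) j
    rw [Subring.coe_add, Subring.coe_mul, Matrix.one_apply, Matrix.one_apply, Pi.single_apply,
      Pi.single_apply]
    split_ifs <;> rfl
  rw [Units.val_mul, e, add_mul, one_mul, Matrix.add_apply, Matrix.vecMulVec_mul]
  simp [Matrix.vecMulVec_apply]

theorem mul_inclK_shear_apply (r : Fin n → 𝒪[F]) (b : Fin n) (h : r ⬝ᵥ Pi.single b 1 = 0)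
    (A : GL (Fin n) F) (i j : Fin n) :
    (A * inclK F n (shear (Pi.single b 1) r h) : GL (Fin n) F).1 i j =
      A.1 i j + A.1 i b * r j := by
  have e : (inclK F n (shear (Pi.single b 1) r h)).1 =
      1 + Matrix.vecMulVec (Pi.single b 1) (fun i => (r i : F)) := by
    ext i j
    change (((1 : Matrix (Fin n) (Fin n) 𝒪[F]) i j + (Pi.single b 1 : Fin n → 𝒪[F]) i * r j :
      𝒪[F]) : F) = (1 : Matrix (Fin n) (Fin n) F) i j + (Pi.single b 1 : Fin n → F) i * r j
    rw [Subring.coe_add, Subring.coe_mul, Matrix.one_apply, Matrix.one_apply, Pi.single_apply,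
      Pi.single_apply]
    split_ifs <;> rfl
  rw [Units.val_mul, e, mul_add, mul_one, Matrix.add_apply, Matrix.mul_vecMulVec]
  simp [Matrix.vecMulVec_apply]

theorem redK_shear_mem_borel (c : Fin n → 𝒪[F]) (a : Fin n) (h : Pi.single a 1 ⬝ᵥ c = 0)
    (hc : ∀ i, a < i → c i ∈ 𝓂[F]) : redK F n (shear c (Pi.single a 1) h) ∈ borel 𝓀[F] n := by
  intro i j hij
  have hij' : j < i := hij
  change IsLocalRing.residue 𝒪[F] ((1 : Matrix (Fin n) (Fin n) 𝒪[F]) i j +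
    c i * (Pi.single a 1 : Fin n → 𝒪[F]) j) = 0
  rw [Matrix.one_apply_ne hij'.ne', zero_add, IsLocalRing.residue_eq_zero_iff]
  by_cases hja : j = a
  · exact Ideal.mul_mem_right _ _ (hc i (hja ▸ hij'))
  · rw [Pi.single_eq_of_ne hja, mul_zero]
    exact zero_mem _

/-- Row `a` of `A` has a unique nonzero entry, and it is alone in its column. -/
def IsPivotRow (A : Matrix (Fin n) (Fin n) F) (a : Fin n) : Prop :=
  ∃ j, A a j ≠ 0 ∧ (∀ j', j' ≠ j → A a j' = 0) ∧ ∀ a', a' ≠ a → A a' j = 0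

theorem exists_insert_isPivotRow (A : GL (Fin n) F) (S : Finset (Fin n)) (hS : S ≠ Finset.univ)
    (hA : ∀ a ∈ S, IsPivotRow A.1 a) :
    ∃ a ∉ S, ∃ ι κ : GL (Fin n) 𝒪[F], redK F n ι ∈ borel 𝓀[F] n ∧
      ∀ b ∈ insert a S, IsPivotRow (inclK F n ι * A * inclK F n κ : GL (Fin n) F).1 b := by
  classical
  obtain ⟨a₀, ha₀⟩ : ∃ a, a ∉ S := by
    by_contra! h
    exact hS (Finset.eq_univ_iff_forall.2 h)
  obtain ⟨j₀, hj₀⟩ : ∃ j, A.1 a₀ j ≠ 0 := by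
    by_contra! h
    have hdet : A.1.det = 0 := Matrix.det_eq_zero_of_row_eq_zero a₀ h
    exact (Matrix.isUnit_iff_isUnit_det _ |>.1 A.isUnit).ne_zero hdet
  let T : Finset (Fin n × Fin n) := Finset.univ.filter fun x => x.1 ∉ S ∧ A.1 x.1 x.2 ≠ 0
  obtain ⟨⟨a, j⟩, haj, hmax⟩ := T.exists_max_image
    (fun x => toLex (valuation F (A.1 x.1 x.2), x.1)) ⟨(a₀, j₀), by simp [T, ha₀, hj₀]⟩
  obtain ⟨haS, haj0⟩ : a ∉ S ∧ A.1 a j ≠ 0 := by simpa [T] using haj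
  have hv0 : 0 < valuation F (A.1 a j) := by simpa [zero_lt_iff] using haj0
  have hmax' : ∀ a' j', a' ∉ S → A.1 a' j' ≠ 0 →
      valuation F (A.1 a' j') < valuation F (A.1 a j) ∨
        valuation F (A.1 a' j') = valuation F (A.1 a j) ∧ a' ≤ a := by
    intro a' j' h1 h2
    have := hmax (a', j') (by simp [T, h1, h2])
    simpa [Prod.Lex.le_iff] using this
  have hSj : ∀ a' ∈ S, A.1 a' j = 0 := by
    intro a' ha'
    obtain ⟨j'', -, h2, h3⟩ := hA a' ha'
    by_cases e : j = j''
    · subst e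
      exact absurd (h3 a fun h => haS (h ▸ ha')) haj0
    · exact h2 j e
  have hle : ∀ a' j', a' ∉ S → valuation F (A.1 a' j' / A.1 a j) ≤ 1 := by
    intro a' j' h
    rw [map_div₀, div_le_one₀ hv0]
    by_cases h0 : A.1 a' j' = 0
    · simp [h0]
    · rcases hmax' a' j' h h0 with h | h
      exacts [h.le, h.1.le]
  have hcint : ∀ a', valuation F (-(A.1 a' j / A.1 a j)) ≤ 1 := by
    intro a'
    rw [Valuation.map_neg]
    by_cases h : a' ∈ S
    · simp [hSj a' h]
    · exact hle a' j h
  let c : Fin n → 𝒪[F] := fun a' => if a' = a then 0 else ⟨-(A.1 a' j / A.1 a j), hcint a'⟩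
  let r : Fin n → 𝒪[F] := fun j' =>
    if j' = j then 0 else ⟨-(A.1 a j' / A.1 a j), by
      change valuation F _ ≤ 1
      rw [Valuation.map_neg]
      exact hle a j' haS⟩
  have hca : c a = 0 := if_pos rfl
  have hrj : r j = 0 := if_pos rfl
  have hc : ∀ a', a' ≠ a → (c a' : F) = -(A.1 a' j / A.1 a j) := fun a' h => by simp [c, h]
  have hr : ∀ j', j' ≠ j → (r j' : F) = -(A.1 a j' / A.1 a j) := fun j' h => by simp [r, h]
  refine ⟨a, haS, shear c (Pi.single a 1) (by simp [hca]), shear (Pi.single j 1) r (by simp [hrj]),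
    redK_shear_mem_borel _ _ _ fun i hi => ?_, ?_⟩
  · rw [mem_maximalIdeal_iff_valuation_lt_one, hc i hi.ne', Valuation.map_neg, map_div₀,
      div_lt_one₀ hv0]
    by_cases h0 : A.1 i j = 0
    · simpa [h0] using hv0
    · rcases hmax' i j (fun h => h0 (hSj i h)) h0 with h | h
      · exact h
      · exact absurd h.2 (not_le.2 hi)
  · set A' := inclK F n (shear c (Pi.single a 1) (by simp [hca])) * A with hA'
    have h1 : ∀ i l, A'.1 i l = A.1 i l + c i * A.1 a l := inclK_shear_mul_apply _ _ _ _
    set A'' := A' * inclK F n (shear (Pi.single j 1) r (by simp [hrj])) with hA''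
    have h2 : ∀ i l, A''.1 i l = A'.1 i l + A'.1 i j * r l := mul_inclK_shear_apply _ _ _ _
    have hrow : ∀ l, A'.1 a l = A.1 a l := fun l => by simp [h1, hca]
    have hcol : ∀ i, i ≠ a → A'.1 i j = 0 := fun i hi => by
      rw [h1, hc i hi]
      field_simp
      ring
    have hother : ∀ i, i ≠ a → ∀ l, A''.1 i l = A'.1 i l := fun i hi l => by
      rw [h2, hcol i hi, zero_mul, add_zero]
    have harow : ∀ l, l ≠ j → A''.1 a l = 0 := fun l hl => by
      rw [h2, hrow, hrow, hr l hl]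
      field_simp
      ring
    have hajj : A''.1 a j = A.1 a j := by rw [h2, hrow, hrj]; simp
    intro b hb
    rcases Finset.mem_insert.1 hb with rfl | hbS
    · exact ⟨j, hajj ▸ haj0, harow, fun i hi => by rw [hother i hi, hcol i hi]⟩
    · have hba : b ≠ a := fun h => haS (h ▸ hbS)
      obtain ⟨l, hl0, hl1, hl2⟩ := hA b hbS
      have hcb : (c b : F) = 0 := by rw [hc b hba, hSj b hbS]; simp
      have hbrow : ∀ m, A''.1 b m = A.1 b m := fun m => by
        rw [hother b hba, h1, hcb, zero_mul, add_zero]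
      have hlj : l ≠ j := fun h => hl0 (h ▸ hSj b hbS)
      refine ⟨l, by rwa [hbrow], fun m hm => by rw [hbrow, hl1 m hm], fun i hi => ?_⟩
      by_cases hia : i = a
      · rw [hia, harow l hlj]
      · rw [hother i hia, h1, hl2 i hi, hl2 a (Ne.symm hba)]
        simp

theorem exists_forall_isPivotRow (y : GL (Fin n) F) :
    ∃ ι κ : GL (Fin n) 𝒪[F], redK F n ι ∈ borel 𝓀[F] n ∧
      ∀ a, IsPivotRow (inclK F n ι * y * inclK F n κ : GL (Fin n) F).1 a := by
  have key : ∀ m ≤ n, ∃ S : Finset (Fin n), S.card = m ∧ ∃ ι κ : GL (Fin n) 𝒪[F],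
      redK F n ι ∈ borel 𝓀[F] n ∧
      ∀ a ∈ S, IsPivotRow (inclK F n ι * y * inclK F n κ : GL (Fin n) F).1 a := by
    intro m
    induction m with
    | zero => exact fun _ => ⟨∅, rfl, 1, 1, by rw [map_one]; exact one_mem _, by simp⟩
    | succ m ih =>
      intro hm
      obtain ⟨S, hSm, ι, κ, hι, hS⟩ := ih (by omega)
      have hne : S ≠ Finset.univ := fun h => by
        rw [h, Finset.card_univ, Fintype.card_fin] at hSm
        omega
      obtain ⟨a, haS, ι', κ', hι', h⟩ := exists_insert_isPivotRow _ S hne hS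
      refine ⟨insert a S, by rw [Finset.card_insert_of_notMem haS, hSm], ι' * ι, κ * κ',
        by rw [map_mul]; exact mul_mem hι' hι, fun b hb => ?_⟩
      have := h b hb
      simpa only [map_mul, mul_assoc] using this
  obtain ⟨S, hS, ι, κ, hι, h⟩ := key n le_rfl
  have hu : S = Finset.univ := by
    rw [← Finset.card_eq_iff_eq_univ, hS, Fintype.card_fin]
  exact ⟨ι, κ, hι, fun a => h a (hu ▸ Finset.mem_univ a)⟩

/-- The permutation matrix whose right multiplication permutes columns by `τ`. -/
def columnPerm (O : Type*) [CommRing O] (τ : Equiv.Perm (Fin n)) : GL (Fin n) O where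
  val := (1 : Matrix (Fin n) (Fin n) O).submatrix id τ
  inv := (1 : Matrix (Fin n) (Fin n) O).submatrix id τ.symm
  val_inv := by
    rw [mul_eq_one_comm]
    ext i j
    simp [Matrix.mul_apply, Matrix.one_apply, Equiv.eq_symm_apply, eq_comm]
  inv_val := by
    ext i j
    simp [Matrix.mul_apply, Matrix.one_apply, Equiv.eq_symm_apply, eq_comm]

theorem mul_inclK_columnPerm_apply (A : GL (Fin n) F) (τ : Equiv.Perm (Fin n)) (i j : Fin n) :
    (A * inclK F n (columnPerm 𝒪[F] τ) : GL (Fin n) F).1 i j = A.1 i (τ j) := by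
  have e : (inclK F n (columnPerm 𝒪[F] τ)).1 = (1 : Matrix (Fin n) (Fin n) F).submatrix id τ := by
    ext i j
    change (((1 : Matrix (Fin n) (Fin n) 𝒪[F]) i (τ j) : 𝒪[F]) : F) =
      (1 : Matrix (Fin n) (Fin n) F) i (τ j)
    rw [Matrix.one_apply, Matrix.one_apply]
    split_ifs <;> rfl
  rw [Units.val_mul, e, Matrix.mul_apply]
  simp [Matrix.one_apply]

theorem redK_mem_borel_of_lt {κ : GL (Fin n) 𝒪[F]}
    (h : ∀ i j, j < i → valuation F ((inclK F n κ).1 i j) < 1) : redK F n κ ∈ borel 𝓀[F] n := by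
  intro i j hij
  change IsLocalRing.residue 𝒪[F] (κ.1 i j) = 0
  rw [IsLocalRing.residue_eq_zero_iff, mem_maximalIdeal_iff_valuation_lt_one]
  exact h i j hij

theorem exists_redK_eq_of_map {B : Matrix (Fin n) (Fin n) 𝒪[F]} {b : FinGL 𝓀[F] n}
    (h : B.map (IsLocalRing.residue 𝒪[F]) = b.1) :
    ∃ κ : GL (Fin n) 𝒪[F], κ.1 = B ∧ redK F n κ = b := by
  have hdet : IsUnit B.det := by
    have h1 : IsLocalRing.residue 𝒪[F] B.det = b.1.det := by
      rw [RingHom.map_det, ← h]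
      rfl
    have h2 : IsUnit b.1.det := (Matrix.isUnit_iff_isUnit_det _).1 b.isUnit
    rw [← h1] at h2
    exact isUnit_of_map_unit (IsLocalRing.residue 𝒪[F]) _ h2
  obtain ⟨κ, hκ⟩ := (Matrix.isUnit_iff_isUnit_det B).2 hdet
  refine ⟨κ, hκ, ?_⟩
  ext i j
  rw [← h, ← hκ]
  rfl

theorem redK_surjective : Function.Surjective (redK F n) := by
  intro b
  choose B hB using fun i j => IsLocalRing.residue_surjective (R := 𝒪[F]) (b.1 i j)
  obtain ⟨κ, -, hκ⟩ := exists_redK_eq_of_map (B := Matrix.of B) (b := b) (by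
    ext i j
    exact hB i j)
  exact ⟨κ, hκ⟩

theorem exists_upperTriangular_redK_eq {b : FinGL 𝓀[F] n} (hb : b ∈ borel 𝓀[F] n) :
    ∃ κ : GL (Fin n) 𝒪[F], κ.1.BlockTriangular id ∧ redK F n κ = b := by
  choose B hB using fun i j => IsLocalRing.residue_surjective (R := 𝒪[F]) (b.1 i j)
  obtain ⟨κ, hκ, hκb⟩ := exists_redK_eq_of_map
    (B := Matrix.of fun i j => if j < i then 0 else B i j) (b := b) (by
      ext i j
      rw [Matrix.map_apply, Matrix.of_apply]
      split_ifs with h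
      · rw [map_zero]
        exact (hb h).symm
      · exact hB i j)
  refine ⟨κ, fun i j hij => ?_, hκb⟩
  rw [hκ]
  exact if_pos hij

/-- If `M` is a monomial matrix whose nonzero entries `d a` are sorted, conjugation by `M` moves
upper triangular integral matrices into the Iwahori subgroup. -/
theorem conj_mem_iwahori (M : GL (Fin n) F) (d : Fin n → F) (r : Equiv.Perm (Fin n))
    (hM : ∀ a b, M.1 a b = if b = r a then d a else 0)
    (hr : ∀ a a', r a ≤ r a' → valuation F (d a) < valuation F (d a') ∨
      valuation F (d a) = valuation F (d a') ∧ a ≤ a')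
    (κ : GL (Fin n) 𝒪[F]) (hκ : κ.1.BlockTriangular id) :
    M * inclK F n κ * M⁻¹ ∈ iwahori F n := by
  have hd : ∀ a, d a ≠ 0 := fun a h0 => by
    have hdet : M.1.det = 0 := Matrix.det_eq_zero_of_row_eq_zero a fun b => by simp [hM, h0]
    exact ((Matrix.isUnit_iff_isUnit_det _).1 M.isUnit).ne_zero hdet
  have hv : ∀ a, 0 < valuation F (d a) := fun a => by simpa [zero_lt_iff] using hd a
  have hentry : ∀ (g : GL (Fin n) F) (a a' : Fin n),
      (M * g * M⁻¹ : GL (Fin n) F).1 a a' = d a * g.1 (r a) (r a') / d a' := by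
    intro g a a'
    rw [eq_div_iff (hd a')]
    have h : (M * g * M⁻¹ * M : GL (Fin n) F).1 a (r a') =
        (M * g : GL (Fin n) F).1 a (r a') := by rw [inv_mul_cancel_right]
    rw [Units.val_mul, Units.val_mul M g, Matrix.mul_apply, Matrix.mul_apply] at h
    simpa [hM] using h
  have hbound : ∀ g : GL (Fin n) F, g.1.BlockTriangular id → (∀ i j, valuation F (g.1 i j) ≤ 1) →
      ∀ a a', valuation F ((M * g * M⁻¹ : GL (Fin n) F).1 a a') ≤ 1 ∧
        (a' < a → valuation F ((M * g * M⁻¹ : GL (Fin n) F).1 a a') < 1) := by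
    intro g hg hg1 a a'
    rw [hentry, map_div₀, map_mul, div_le_one₀ (hv a'), div_lt_one₀ (hv a')]
    by_cases h : r a' < r a
    · rw [hg h]
      simpa using fun _ => hv a'
    · have hmul : valuation F (d a) * valuation F (g.1 (r a) (r a')) ≤ valuation F (d a) :=
        mul_le_of_le_one_right' (hg1 _ _)
      rcases hr a a' (not_lt.1 h) with h' | h'
      · exact ⟨hmul.trans h'.le, fun _ => hmul.trans_lt h'⟩
      · exact ⟨hmul.trans h'.1.le, fun hlt => absurd h'.2 (not_le.2 hlt)⟩
  have htri : (inclK F n κ).1.BlockTriangular id := fun i j hij => by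
    change ((κ.1 i j : 𝒪[F]) : F) = 0
    rw [hκ hij]
    rfl
  have h1 := hbound _ htri fun i j => (κ.1 i j).2
  have h2 := hbound _ (blockTriangular_inv htri) fun i j => by
    rw [← map_inv]
    exact ((κ⁻¹).1 i j).2
  obtain ⟨κ', hκ'⟩ := exists_inclK_eq (M * inclK F n κ * M⁻¹) (fun i j => (h1 i j).1) fun i j => by
    have : (M * inclK F n κ * M⁻¹)⁻¹ = M * (inclK F n κ)⁻¹ * M⁻¹ := by group
    rw [this]
    exact (h2 i j).1
  refine ⟨κ', redK_mem_borel_of_lt fun i j hij => ?_, hκ'⟩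
  rw [hκ']
  exact (h1 i j).2 hij

/-- The image in `G_f` of `K ∩ y⁻¹ I y` contains a conjugate of the Borel subgroup. -/
theorem exists_borel_conj_lift (y : GL (Fin n) F) :
    ∃ k : GL (Fin n) 𝒪[F], ∀ b ∈ borel 𝓀[F] n, ∃ κ : GL (Fin n) 𝒪[F],
      redK F n κ = b ∧ y * inclK F n (k * κ * k⁻¹) * y⁻¹ ∈ iwahori F n := by
  obtain ⟨ι, κ₀, hι, hpiv⟩ := exists_forall_isPivotRow y
  set A := inclK F n ι * y * inclK F n κ₀ with hA
  choose c hc0 hrow hcol using hpiv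
  have hcinj : Function.Injective c := fun a a' h => by
    by_contra hne
    exact hc0 a' (h ▸ hcol a a' (Ne.symm hne))
  let e : Equiv.Perm (Fin n) := Equiv.ofBijective c (Finite.injective_iff_bijective.1 hcinj)
  let d : Fin n → F := fun a => A.1 a (c a)
  let f : Fin n → ValueGroupWithZero F ×ₗ Fin n := fun a => toLex (valuation F (d a), a)
  let s := Tuple.sort f
  let P := columnPerm 𝒪[F] (s.trans e)
  refine ⟨κ₀ * P, fun b hb => ?_⟩
  obtain ⟨κ, hκ, hκb⟩ := exists_upperTriangular_redK_eq hb
  refine ⟨κ, hκb, ?_⟩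
  have hmem := conj_mem_iwahori (A * inclK F n P) d s.symm (fun a b => by
      rw [mul_inclK_columnPerm_apply]
      split_ifs with h
      · subst h
        change A.1 a (c (s (s.symm a))) = _
        rw [Equiv.apply_symm_apply]
      · refine hrow a _ fun h' => h ?_
        have : s b = a := hcinj h'
        rw [← this, Equiv.symm_apply_apply]) (fun a a' h => by
      have := Tuple.monotone_sort f h
      simpa [f, s, Prod.Lex.le_iff] using this) κ hκ
  have hιI : inclK F n ι ∈ iwahori F n := ⟨ι, hι, rfl⟩
  have := mul_mem (mul_mem (inv_mem hιI) hmem) hιI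
  convert this using 1
  simp only [hA, map_mul, map_inv]
  group

end Iwahori

section Smooth

open Topology

variable {R : Type*} [Field R]

theorem conj_mem_nhds_one {G : Type*} [Group G] [TopologicalSpace G] [IsTopologicalGroup G]
    (L : Subgroup G) (hL : IsOpen (L : Set G)) (s : Finset G) :
    {u : G | ∀ x ∈ s, x * u * x⁻¹ ∈ L} ∈ 𝓝 1 := by
  have e : {u : G | ∀ x ∈ s, x * u * x⁻¹ ∈ L} = ⋂ x ∈ s, (fun u => x * u * x⁻¹) ⁻¹' L := by
    ext
    simp
  rw [e]
  refine (Filter.biInter_finset_mem s).2 fun x _ => (hL.preimage (by fun_prop)).mem_nhds ?_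
  simp

/-- Vectors of a representation compactly induced from an open subgroup are smooth. -/
theorem stabilizer_cInd_mem_nhds_one {H G : Type*} [Group H] [Group G] [TopologicalSpace G]
    [IsTopologicalGroup G] {V : Type*} [AddCommGroup V] [Module R V] (φ : H →* G)
    (ρ : Representation R H V) (L : Subgroup G) (hLo : IsOpen (L : Set G))
    (hL : ∀ g ∈ L, ∃ h, φ h = g ∧ ρ h = 1) (f : cIndV φ ρ) :
    {u | cInd φ ρ u f = f} ∈ 𝓝 1 := by
  obtain ⟨s, hs⟩ := exists_finset_right_invariant φ ρ L hL f
  exact Filter.mem_of_superset (conj_mem_nhds_one L hLo s) hs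

theorem isLocallyConstant_of_right_invariant {G X : Type*} [Group G] [TopologicalSpace G]
    [IsTopologicalGroup G] (L : Subgroup G) (hL : IsOpen (L : Set G)) (f : G → X)
    (hf : ∀ u ∈ L, ∀ g, f (g * u) = f g) : IsLocallyConstant f := by
  rw [IsLocallyConstant.iff_eventually_eq]
  intro g
  have : (fun x => g⁻¹ * x) ⁻¹' (L : Set G) ∈ 𝓝 g :=
    (hL.preimage (by fun_prop)).mem_nhds (by simp)
  filter_upwards [this] with x hx
  have := hf _ hx g
  rwa [mul_inv_cancel_left] at this

variable (F : Type*) [Field F] [ValuativeRel F] [TopologicalSpace F] [IsNonarchimedeanLocalField F]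
variable (n : ℕ)

/-- An element of the Hecke algebra is right invariant under an open subgroup. -/
theorem right_invariant_mem_nhds_one {f : GL (Fin n) F → R}
    (hf : f ∈ heckeAlgebra R (GL (Fin n) F)) :
    {u | ∀ g, f (g * u) = f g} ∈ 𝓝 1 := by
  obtain ⟨hlc, hcs⟩ := hf
  have hloc : ∀ g : GL (Fin n) F, ∃ m, ∀ u ∈ congruenceImage F n m, f (g * u) = f g := by
    intro g
    have h1 : {x | f x = f g} ∈ 𝓝 (g * 1) := by
      rw [mul_one]
      exact (IsLocallyConstant.iff_eventually_eq f).1 hlc g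
    obtain ⟨m, hm⟩ := exists_congruenceImage_subset F n
      ((continuous_const_mul g).continuousAt.preimage_mem_nhds h1)
    exact ⟨m, fun u hu => hm hu⟩
  choose m hm using hloc
  obtain ⟨t, -, ht⟩ := hcs.isCompact.elim_nhds_subcover
    (fun g => (fun x => g⁻¹ * x) ⁻¹' (congruenceImage F n (m g) : Set (GL (Fin n) F)))
    fun g _ => ((isOpen_congruenceImage F n (m g)).preimage (by fun_prop)).mem_nhds (by simp)
  have aux : ∀ u, (∀ g ∈ t, u ∈ congruenceImage F n (m g)) → ∀ x, f x ≠ 0 → f (x * u) = f x := by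
    intro u hu x hx
    obtain ⟨g, hg, hxg⟩ := Set.mem_iUnion₂.1 (ht (subset_tsupport f hx))
    have h1 := hm g _ hxg
    have h2 := hm g _ (mul_mem hxg (hu g hg))
    rw [mul_inv_cancel_left] at h1
    rw [← mul_assoc, mul_inv_cancel_left] at h2
    rw [h1, h2]
  have hN : ⋂ g ∈ t, (congruenceImage F n (m g) : Set (GL (Fin n) F)) ∈ 𝓝 1 :=
    (Filter.biInter_finset_mem t).2 fun g _ =>
      (isOpen_congruenceImage F n (m g)).mem_nhds (one_mem _)
  filter_upwards [hN] with u hu x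
  have hu' : ∀ g ∈ t, u ∈ congruenceImage F n (m g) := Set.mem_iInter₂.1 hu
  by_cases hx : f x = 0
  · by_contra hne
    have h := aux u⁻¹ (fun g hg => inv_mem (hu' g hg)) (x * u) (by rw [hx] at hne; exact hne)
    rw [mul_inv_cancel_right] at h
    exact hne h.symm
  · exact aux u hu' x hx

theorem finite_support_of_hasCompactSupport {f : GL (Fin n) F → R} (hf : HasCompactSupport f)
    (U : Subgroup (GL (Fin n) F)) (hU : IsOpen (U : Set (GL (Fin n) F))) :
    (Function.support fun x : GL (Fin n) F ⧸ U => f x.out).Finite := by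
  obtain ⟨t, -, ht⟩ := hf.isCompact.elim_nhds_subcover
    (fun g => (fun x => g⁻¹ * x) ⁻¹' (U : Set (GL (Fin n) F)))
    fun g _ => (hU.preimage (by fun_prop)).mem_nhds (by simp)
  refine (t.finite_toSet.image fun g : GL (Fin n) F => (g : GL (Fin n) F ⧸ U)).subset fun x hx => ?_
  obtain ⟨g, hg, hxg⟩ := Set.mem_iUnion₂.1 (ht (subset_tsupport f hx))
  refine ⟨g, hg, ?_⟩
  rw [← QuotientGroup.out_eq' x]
  exact QuotientGroup.eq.2 hxg

/-- The Hecke algebra action commutes with intertwining maps on smooth vectors. -/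
theorem heckeAction_intertwining_of_smooth {p : ℕ} [Fact p.Prime] [CharP 𝓀[F] p]
    (hp : (p : R) ≠ 0) {V W : Type*} [AddCommGroup V] [Module R V] [AddCommGroup W] [Module R W]
    (ρ : Representation R (GL (Fin n) F) V) (σ : Representation R (GL (Fin n) F) W)
    (T : ρ.IntertwiningMap σ) {f : GL (Fin n) F → R} (hf : f ∈ heckeAlgebra R (GL (Fin n) F))
    (v : V) (hv : {u | ρ u v = v} ∈ 𝓝 1) :
    T (heckeAction (proRadical F n) ρ f v) = heckeAction (proRadical F n) σ f (T v) := by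
  obtain ⟨m, hm⟩ := exists_congruenceImage_subset F n
    (Filter.inter_mem (right_invariant_mem_nhds_one F n hf) hv)
  exact heckeAction_intertwining _ ρ σ T f v (congruenceImage F n m) (congruenceImage_le F n m)
    (relIndex_congruenceImage_ne_zero F n hp m) (fun u hu => (hm hu).1) (fun u hu => (hm hu).2)
    (finite_support_of_hasCompactSupport F n hf.2 _ (isOpen_congruenceImage F n m))

end Smooth

section Inflation

variable {F : Type*} [Field F] [ValuativeRel F] {n : ℕ} {R : Type*} [Field R]

open Classical in
/-- The function on `G` that is the inflation of `z` on `K` and zero elsewhere. -/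
def inflFun (z : FinGL 𝓀[F] n → R) (g : GL (Fin n) F) : R :=
  if h : ∃ κ, inclK F n κ = g then z (redK F n h.choose) else 0

theorem inflFun_inclK (z : FinGL 𝓀[F] n → R) (κ : GL (Fin n) 𝒪[F]) :
    inflFun z (inclK F n κ) = z (redK F n κ) := by
  have h : ∃ κ', inclK F n κ' = inclK F n κ := ⟨κ, rfl⟩
  have e : h.choose = κ := inclK_injective h.choose_spec
  simp only [inflFun, dif_pos h, e]

theorem inflFun_of_notMem (z : FinGL 𝓀[F] n → R) {g : GL (Fin n) F}
    (hg : g ∉ Set.range (inclK F n)) : inflFun z g = 0 :=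
  dif_neg hg

theorem inflFun_mul (z : FinGL 𝓀[F] n → R) {u : GL (Fin n) F} (hu : u ∈ proRadical F n)
    (g : GL (Fin n) F) : inflFun z (g * u) = inflFun z g := by
  obtain ⟨κ₁, hκ₁, rfl⟩ := hu
  by_cases hg : g ∈ Set.range (inclK F n)
  · obtain ⟨κ, rfl⟩ := hg
    rw [← map_mul, inflFun_inclK, inflFun_inclK, map_mul, MonoidHom.mem_ker.1 hκ₁, mul_one]
  · rw [inflFun_of_notMem z hg, inflFun_of_notMem]
    rintro ⟨κ, hκ⟩
    exact hg ⟨κ * κ₁⁻¹, by rw [map_mul, hκ, map_inv, mul_inv_cancel_right]⟩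

theorem inflFun_mem_heckeAlgebra [TopologicalSpace F] [IsNonarchimedeanLocalField F]
    (z : FinGL 𝓀[F] n → R) : inflFun z ∈ heckeAlgebra R (GL (Fin n) F) := by
  have := compactSpace_GL_integers F n
  have := t2Space_GL F n
  refine ⟨isLocallyConstant_of_right_invariant (proRadical F n) (isOpen_proRadical F n) _
    fun u hu g => inflFun_mul z hu g, ?_⟩
  exact HasCompactSupport.intro (isCompact_range (continuous_inclK F n))
    fun g hg => inflFun_of_notMem z hg

theorem heckeAction_inflFun {V : Type*} [AddCommGroup V] [Module R V]
    (ρ : Representation R (GL (Fin n) F) V) (z : FinGL 𝓀[F] n → R) (L : Subgroup (GL (Fin n) 𝒪[F]))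
    (hL : L ≤ (redK F n).ker) [Fintype (GL (Fin n) 𝒪[F] ⧸ L)]
    (hidx : (((L.map (inclK F n)).relIndex (proRadical F n) : ℕ) : R) ≠ 0) (v : V)
    (hv : ∀ u ∈ L, ρ (inclK F n u) v = v) :
    heckeAction (proRadical F n) ρ (inflFun z) v =
      (((L.map (inclK F n)).relIndex (proRadical F n) : ℕ) : R)⁻¹ •
        ∑ q : GL (Fin n) 𝒪[F] ⧸ L, z (redK F n q.out) • ρ (inclK F n q.out) v := by
  set U := L.map (inclK F n) with hU
  have hUP : U ≤ proRadical F n := Subgroup.map_mono hL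
  have hinv : ∀ u ∈ U, ∀ g, inflFun z (g * u) • ρ (g * u) v = inflFun z g • ρ g v := by
    intro u hu g
    rw [inflFun_mul z (hUP hu)]
    obtain ⟨κ, hκ, rfl⟩ := hu
    rw [map_mul, Module.End.mul_apply, hv κ hκ]
  let J : GL (Fin n) 𝒪[F] ⧸ L → GL (Fin n) F ⧸ U := fun q => (inclK F n q.out : GL (Fin n) F ⧸ U)
  have hJ : Function.Injective J := by
    intro q q' h
    obtain ⟨u, hu, hue⟩ := QuotientGroup.eq.1 h
    rw [← map_inv, ← map_mul] at hue
    rw [← QuotientGroup.out_eq' q, ← QuotientGroup.out_eq' q']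
    refine QuotientGroup.eq.2 ?_
    rw [← inclK_injective hue]
    exact hu
  have hsupp : (Function.support fun x : GL (Fin n) F ⧸ U => inflFun z x.out • ρ x.out v) ⊆
      Set.range J := by
    intro x hx
    have h1 : inflFun z x.out ≠ 0 := fun h => hx (by simp [h])
    obtain ⟨κ, hκ⟩ : x.out ∈ Set.range (inclK F n) := by
      by_contra h
      exact h1 (inflFun_of_notMem z h)
    refine ⟨(κ : GL (Fin n) 𝒪[F] ⧸ L), ?_⟩
    rw [← QuotientGroup.out_eq' x, ← hκ]
    obtain ⟨u, hu⟩ := QuotientGroup.mk_out_eq_mul L κ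
    change ((inclK F n (κ : GL (Fin n) 𝒪[F] ⧸ L).out : GL (Fin n) F) : GL (Fin n) F ⧸ U) = _
    rw [hu, map_mul]
    exact QuotientGroup.mk_mul_of_mem _ ⟨u, u.2, rfl⟩
  unfold heckeAction
  rw [haarIntegral_eq_of_le (proRadical F n) (fun g => inflFun z g • ρ g v) U hUP hinv hidx
    ((Set.finite_range J).subset hsupp)]
  congr 1
  rw [← finsum_mem_univ, ← finsum_mem_inter_support,
    Set.univ_inter, ← Set.inter_eq_right.2 hsupp, finsum_mem_inter_support, finsum_mem_range hJ,
    finsum_eq_sum_of_fintype]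
  refine Finset.sum_congr rfl fun q _ => ?_
  rw [apply_out_eq (φ := fun g => inflFun z g • ρ g v) hinv, inflFun_inclK]

end Inflation

section Annihilators

variable {F : Type*} [Field F] [ValuativeRel F] [TopologicalSpace F] [IsNonarchimedeanLocalField F]
variable {n : ℕ} {R : Type*} [Field R]

theorem isOpen_iwahori : IsOpen (iwahori F n : Set (GL (Fin n) F)) := by
  refine Subgroup.isOpen_mono (Subgroup.map_mono fun κ hκ => ?_) (isOpen_proRadical F n)
  rw [Subgroup.mem_comap, MonoidHom.mem_ker.1 hκ]
  exact one_mem _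

/-- The inflation to `K` of an element of the annihilator of `P_f` annihilates `P`. -/
theorem inflFun_mem_heckeAnn {p : ℕ} [Fact p.Prime] [CharP 𝓀[F] p] (hp : (p : R) ≠ 0)
    [Fintype (FinGL 𝓀[F] n)] (z : FinGL 𝓀[F] n → R)
    (hz : groupAlgebraOf z ∈ groupAnn (finP 𝓀[F] n R)) :
    inflFun z ∈ heckeAnn (proRadical F n) (padicP F n R) := by
  classical
  refine ⟨inflFun_mem_heckeAlgebra z, fun w => ?_⟩
  obtain ⟨m, hm⟩ := exists_congruenceImage_subset F n
    (stabilizer_cInd_mem_nhds_one (iwahori F n).subtype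
      (Representation.trivial R (iwahori F n) R) (iwahori F n) isOpen_iwahori
      (fun g hg => ⟨⟨g, hg⟩, rfl, rfl⟩) w)
  set L := congruenceSubgroup n (𝓂[F] ^ (m + 1)) with hLdef
  have hL : L ≤ (redK F n).ker := by
    rw [ker_redK_eq]
    exact congruenceSubgroup_mono (Ideal.pow_le_self (by omega))
  have hfinq := finite_quotient_maximalIdeal_pow F (m + 1)
  have : L.FiniteIndex := by
    have : Finite (GL (Fin n) (𝒪[F] ⧸ 𝓂[F] ^ (m + 1))) := inferInstance
    rw [hLdef]
    unfold congruenceSubgroup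
    infer_instance
  have : Finite (GL (Fin n) 𝒪[F] ⧸ L) := Subgroup.finite_quotient_of_finiteIndex
  have := Fintype.ofFinite (GL (Fin n) 𝒪[F] ⧸ L)
  have hw : ∀ u ∈ L, ∀ g, w.1 (g * inclK F n u) = w.1 g := fun u hu g => by
    have : padicP F n R (inclK F n u) w = w := hm ⟨u, hu, rfl⟩
    exact congrArg (fun w => w.1 g) this
  rw [heckeAction_inflFun (padicP F n R) z L hL (relIndex_congruenceImage_ne_zero F n hp m) w
    fun u hu => hm ⟨u, hu, rfl⟩]
  refine smul_eq_zero_of_right _ ?_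
  ext y
  refine (sum_smul_cInd_apply _ _ _ _ _ w y).trans ?_
  change _ = (0 : R)
  obtain ⟨k, hk⟩ := exists_borel_conj_lift y
  let W : GL (Fin n) 𝒪[F] → R := fun κ => w.1 (y * inclK F n κ)
  have hW : ∀ κ : GL (Fin n) 𝒪[F], W (κ : GL (Fin n) 𝒪[F] ⧸ L).out = W κ :=
    apply_out_eq fun u hu g => by
      change w.1 (y * inclK F n (g * u)) = _
      rw [map_mul, ← mul_assoc, hw u hu]
  have hred : ∀ κ : GL (Fin n) 𝒪[F], redK F n (κ : GL (Fin n) 𝒪[F] ⧸ L).out = redK F n κ :=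
    apply_out_eq fun u hu g => by rw [map_mul, MonoidHom.mem_ker.1 (hL hu), mul_one]
  let h₀ : FinGL 𝓀[F] n → R := fun g =>
    ∑ q : GL (Fin n) 𝒪[F] ⧸ L, if redK F n q.out = redK F n k * g then W q.out else 0
  have hinv : ∀ b ∈ borel 𝓀[F] n, ∀ g, h₀ (b * g) = h₀ g := by
    intro b hb g
    obtain ⟨κ, rfl, hκ⟩ := hk b hb
    refine (Fintype.sum_equiv (MulAction.toPerm (k * κ * k⁻¹)) _ _ fun q => ?_).symm
    obtain ⟨κ', rfl⟩ := QuotientGroup.mk_surjective q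
    have hq : MulAction.toPerm (k * κ * k⁻¹) (κ' : GL (Fin n) 𝒪[F] ⧸ L) =
        ((k * κ * k⁻¹ * κ' : GL (Fin n) 𝒪[F]) : GL (Fin n) 𝒪[F] ⧸ L) := rfl
    rw [hq, hred, hW, hred, hW]
    have hWκ : W (k * κ * k⁻¹ * κ') = W κ' := by
      change w.1 (y * inclK F n (k * κ * k⁻¹ * κ')) = w.1 (y * inclK F n κ')
      have := w.2.1 ⟨_, hκ⟩ (y * inclK F n κ')
      refine Eq.trans (congrArg w.1 ?_) this
      rw [map_mul (inclK F n) (k * κ * k⁻¹), Subgroup.subtype_apply]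
      group
    have hcond : redK F n (k * κ * k⁻¹ * κ') = redK F n k * (redK F n κ * g) ↔
        redK F n κ' = redK F n k * g := by
      rw [map_mul, map_mul, map_mul, map_inv, mul_assoc, mul_assoc, mul_right_inj, mul_right_inj,
        inv_mul_eq_iff_eq_mul]
    rw [hWκ]
    simp only [hcond]
  let h : cIndV (borel 𝓀[F] n).subtype (Representation.trivial R (borel 𝓀[F] n) R) :=
    ⟨h₀, fun b g => hinv b b.2 g, Finset.univ, fun g _ => ⟨1, g, Finset.mem_univ _, by simp⟩⟩
  have hzero := (groupAlgebraOf_mem_groupAnn_iff (finP 𝓀[F] n R) z).1 hz h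
  have heval := congrArg (fun f => f.1 (redK F n k)⁻¹) hzero
  have heval' : ∑ g, z g • h₀ ((redK F n k)⁻¹ * g) = 0 :=
    (sum_smul_cInd_apply _ _ Finset.univ z (fun g => g) h _).symm.trans heval
  rw [← heval']
  simp only [h₀, mul_inv_cancel_left, Finset.smul_sum]
  rw [Finset.sum_comm]
  refine Finset.sum_congr rfl fun q _ => ?_
  rw [Finset.sum_eq_single (redK F n q.out) (fun g _ hg => by rw [if_neg (Ne.symm hg), smul_zero])
    (by simp), if_pos rfl]

/-- The inflation to `K` of `z` acts on functions supported on `K` through `z`. -/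
theorem heckeAction_inflFun_cIndSingle [Fintype (FinGL 𝓀[F] n)] {V : Type*} [AddCommGroup V]
    [Module R V] (ρ : Representation R (FinGL 𝓀[F] n) V) (z : FinGL 𝓀[F] n → R) (v : V) :
    heckeAction (proRadical F n) (parahoricInd ρ) (inflFun z)
        (cIndSingle (inclK F n) inclK_injective (inflK ρ) v) =
      cIndSingle (inclK F n) inclK_injective (inflK ρ) (∑ g, z g • ρ g v) := by
  have hK : ∀ κ v, parahoricInd ρ (inclK F n κ) (cIndSingle (inclK F n) inclK_injective
      (inflK ρ) v) = cIndSingle (inclK F n) inclK_injective (inflK ρ) (ρ (redK F n κ) v) := by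
    intro κ v
    ext g
    change (cIndSingle (inclK F n) inclK_injective (inflK ρ) v).1 (g * inclK F n κ) = _
    by_cases hg : g ∈ Set.range (inclK F n)
    · obtain ⟨κ', rfl⟩ := hg
      rw [← map_mul, cIndSingle_apply_map, cIndSingle_apply_map, map_mul]
      rfl
    · rw [cIndSingle_apply_of_notMem, cIndSingle_apply_of_notMem]
      · exact fun a ha => hg ⟨a, ha⟩
      · exact fun a ha => hg ⟨a * κ⁻¹, by rw [map_mul, ha, map_inv, mul_inv_cancel_right]⟩
  have : Finite (GL (Fin n) 𝒪[F] ⧸ (redK F n).ker) :=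
    Finite.of_injective _ (QuotientGroup.kerLift_injective (redK F n))
  have := Fintype.ofFinite (GL (Fin n) 𝒪[F] ⧸ (redK F n).ker)
  have hidx : ((redK F n).ker.map (inclK F n)).relIndex (proRadical F n) = 1 :=
    Subgroup.relIndex_self _
  rw [heckeAction_inflFun (parahoricInd ρ) z (redK F n).ker le_rfl (by rw [hidx]; simp), hidx,
    Nat.cast_one, inv_one, one_smul, map_sum]
  · refine Fintype.sum_equiv (QuotientGroup.quotientKerEquivOfSurjective (redK F n)
      redK_surjective).toEquiv _ _ fun q => ?_
    have hq : (QuotientGroup.quotientKerEquivOfSurjective (redK F n) redK_surjective).toEquiv q =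
        redK F n q.out := by
      conv_lhs => rw [← QuotientGroup.out_eq' q]
      rfl
    rw [hq, hK, map_smul]
  · intro u hu
    rw [hK, MonoidHom.mem_ker.1 hu, map_one, Module.End.one_apply]

/-- The intertwining map `Γ → P` attached to a functional on `Γ_f` invariant under the Borel
subgroup. -/
def toPadicP {V : Type*} [AddCommGroup V] [Module R V] (ρ : Representation R (FinGL 𝓀[F] n) V)
    (a : V →ₗ[R] R) (ha : ∀ b ∈ borel 𝓀[F] n, ∀ v, a (ρ b v) = a v) :
    (parahoricInd ρ).IntertwiningMap (padicP F n R) where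
  toFun f := ⟨fun g => a (f.1 g), by
    classical
    obtain ⟨hf, s, hs⟩ := f.2
    have := Fintype.ofFinite (FinGL 𝓀[F] n)
    refine ⟨?_, (Finset.univ ×ˢ s).image fun x =>
      inclK F n (Function.surjInv (redK_surjective (F := F) (n := n)) x.1) * x.2, fun g hg => ?_⟩
    · rintro ⟨_, κ, hκ, rfl⟩ g
      refine (congrArg a (hf κ g)).trans ?_
      exact ha _ hκ _
    · obtain ⟨κ, x, hx, rfl⟩ := hs g fun h => hg ((congrArg a h).trans (map_zero a))
      set κ' := Function.surjInv (redK_surjective (F := F) (n := n)) (redK F n κ) with hκ'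
      have hred : redK F n κ' = redK F n κ := Function.surjInv_eq _ _
      refine ⟨⟨inclK F n (κ * κ'⁻¹), κ * κ'⁻¹, ?_, rfl⟩, inclK F n κ' * x,
        Finset.mem_image.2 ⟨(redK F n κ, x), by simp [hx], rfl⟩, ?_⟩
      · change redK F n (κ * κ'⁻¹) ∈ borel 𝓀[F] n
        rw [map_mul, map_inv, hred, mul_inv_cancel]
        exact one_mem _
      · change _ = inclK F n (κ * κ'⁻¹) * _
        rw [map_mul, map_inv]
        group⟩
  map_add' f f' := by
    ext g
    exact map_add a _ _
  map_smul' r f := by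
    ext g
    exact map_smul a _ _
  isIntertwining' g := rfl

/-- `I Γ` consists of the functions in `Γ` with values in `I_f Γ_f`. -/
theorem mem_padicAnnGamma_iff {p : ℕ} [Fact p.Prime] [CharP 𝓀[F] p] (hp : (p : R) ≠ 0)
    (v : PadicGammaV F n R) :
    v ∈ padicAnnGamma F n R ↔ ∀ g, v.1 g ∈ finAnnGamma 𝓀[F] n R := by
  constructor
  · intro hv
    induction hv using Submodule.span_induction with
    | zero => exact fun g => zero_mem _
    | add x y _ _ hx hy => exact fun g => add_mem (hx g) (hy g)
    | smul r x _ hx => exact fun g => Submodule.smul_mem _ r (hx g)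
    | mem w hw =>
      obtain ⟨f, ⟨hf, hfP⟩, v, rfl⟩ := hw
      intro g
      refine mem_finAnnGamma_of_invariant_functionals hp _ fun a ha y => ?_
      obtain ⟨κ, rfl⟩ := redK_surjective y
      have hT := heckeAction_intertwining_of_smooth F n hp (padicGamma F n R) (padicP F n R)
        (toPadicP (finGamma 𝓀[F] n R) a ha) hf v
        (stabilizer_cInd_mem_nhds_one (inclK F n) (inflK (finGamma 𝓀[F] n R)) (proRadical F n)
          (isOpen_proRadical F n) (by
            rintro _ ⟨u, hu, rfl⟩
            refine ⟨u, rfl, ?_⟩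
            change finGamma 𝓀[F] n R (redK F n u) = 1
            rw [MonoidHom.mem_ker.1 hu, map_one]) v)
      rw [hfP] at hT
      have h1 : a ((heckeAction (proRadical F n) (padicGamma F n R) f v).1 (inclK F n κ * g)) = 0 :=
        congrArg (fun w => w.1 (inclK F n κ * g)) hT
      rw [(heckeAction (proRadical F n) (padicGamma F n R) f v).2.1 κ g] at h1
      exact h1
  · intro hv
    have := Fintype.ofFinite (FinGL 𝓀[F] n)
    refine mem_of_cIndSingle_mem (inclK F n) inclK_injective (inflK (finGamma 𝓀[F] n R))
      (finAnnGamma 𝓀[F] n R) (padicAnnGamma F n R) (heckeAnnSpan_stable _ _ _) (fun u hu => ?_) v hv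
    induction hu using Submodule.span_induction with
    | zero => rw [map_zero]; exact zero_mem _
    | add x y _ _ hx hy => rw [map_add]; exact add_mem hx hy
    | smul r x _ hx => rw [map_smul]; exact Submodule.smul_mem _ r hx
    | mem w hw =>
      obtain ⟨z, hz, u, rfl⟩ := hw
      obtain ⟨z, rfl⟩ := exists_groupAlgebraOf_eq z
      rw [asAlgebraHom_groupAlgebraOf]
      exact Submodule.subset_span ⟨inflFun z, inflFun_mem_heckeAnn hp z hz, _,
        heckeAction_inflFun_cIndSingle (finGamma 𝓀[F] n R) z u⟩

/-- Parahoric induction preserves surjectivity. -/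
theorem parahoricIndMap_surjective {F : Type*} [Field F] [ValuativeRel F] {n : ℕ} {V W : Type*}
    [AddCommGroup V] [Module R V] [AddCommGroup W] [Module R W]
    {ρ : Representation R (FinGL 𝓀[F] n) V} {σ : Representation R (FinGL 𝓀[F] n) W}
    (T : ρ.IntertwiningMap σ) (hT : Function.Surjective T) :
    Function.Surjective (parahoricIndMap T) := by
  intro f
  have : f ∈ LinearMap.range (parahoricIndMap T).toLinearMap := by
    refine mem_of_cIndSingle_mem (inclK F n) inclK_injective (inflK σ) ⊤ _ ?_ ?_ f fun _ => trivial
    · rintro g _ ⟨x, rfl⟩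
      exact ⟨parahoricInd ρ g x, (parahoricIndMap T).isIntertwining _ _ g x⟩
    · intro w _
      obtain ⟨v, rfl⟩ := hT w
      refine ⟨cIndSingle (inclK F n) inclK_injective (inflK ρ) v, ?_⟩
      ext g
      change T ((cIndSingle (inclK F n) inclK_injective (inflK ρ) v).1 g) = _
      by_cases hg : g ∈ Set.range (inclK F n)
      · obtain ⟨κ, rfl⟩ := hg
        rw [cIndSingle_apply_map, cIndSingle_apply_map]
        exact T.isIntertwining _ _ _ _
      · rw [cIndSingle_apply_of_notMem _ _ _ _ fun a ha => hg ⟨a, ha⟩,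
          cIndSingle_apply_of_notMem _ _ _ _ fun a ha => hg ⟨a, ha⟩, map_zero]
  exact this

theorem ker_parahoricIndMap_finQuotientMap {p : ℕ} [Fact p.Prime] [CharP 𝓀[F] p]
    (hp : (p : R) ≠ 0) :
    padicAnnGamma F n R =
      LinearMap.ker (parahoricIndMap (F := F) (finQuotientMap 𝓀[F] n R)).toLinearMap := by
  ext v
  rw [mem_padicAnnGamma_iff hp, LinearMap.mem_ker]
  constructor
  · intro h
    ext g
    exact (Submodule.Quotient.mk_eq_zero _).2 (h g)
  · intro h g
    exact (Submodule.Quotient.mk_eq_zero _).1 (congrArg (fun f => f.1 g) h)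

end Annihilators

end ParahoricGen

end

theorem mainTheorem4
    (F : Type*) [Field F] [ValuativeRel F] [TopologicalSpace F] [IsNonarchimedeanLocalField F]
    (R : Type*) [Field R] [IsAlgClosed R]
    (p l : ℕ) [CharP 𝓀[F] p] [CharP R l] (hlp : l ≠ p) (n : ℕ) :
    ∃ e : (ParahoricGen.padicQ F n R).Equiv
        (ParahoricGen.parahoricInd (ParahoricGen.finQ 𝓀[F] n R)),
      ∀ v : ParahoricGen.PadicGammaV F n R,
        e (ParahoricGen.padicQuotientMap F n R v) =
          ParahoricGen.parahoricIndMap (ParahoricGen.finQuotientMap 𝓀[F] n R) v := by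
  have hprime : p.Prime :=
    (CharP.char_is_prime_or_zero 𝓀[F] p).resolve_right (CharP.char_ne_zero_of_finite 𝓀[F] p)
  have : Fact p.Prime := ⟨hprime⟩
  have hp : (p : R) ≠ 0 := fun h => by
    rcases (Nat.dvd_prime hprime).1 ((CharP.cast_eq_zero_iff R l p).1 h) with h | h
    · exact CharP.char_ne_one R l h
    · exact hlp h
  set T := ParahoricGen.parahoricIndMap (F := F) (ParahoricGen.finQuotientMap 𝓀[F] n R) with hT
  have hsurj : Function.Surjective T.toLinearMap :=
    ParahoricGen.parahoricIndMap_surjective _ (Submodule.mkQ_surjective _)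
  let E := (Submodule.quotEquivOfEq _ _
    (ParahoricGen.ker_parahoricIndMap_finQuotientMap (F := F) (n := n) hp)).trans
      (T.toLinearMap.quotKerEquivOfSurjective hsurj)
  have hE : ∀ v, E (Submodule.Quotient.mk v) = T v := fun v => rfl
  refine ⟨Representation.Equiv.mk E fun g => ?_, hE⟩
  refine LinearMap.ext fun x => ?_
  obtain ⟨v, rfl⟩ := Submodule.Quotient.mk_surjective _ x
  exact T.isIntertwining _ _ g v
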